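/- Let $\mathfrak g$ be a finite-dimensional complex semisimple Lie algebra with Cartan subalgebra $\mathfrak h$, simple roots $\alpha_1,\dots,\alpha_n$ (numbered as in Bourbaki and Humphreys), root lattice $Q$ and weight lattice $P$. Let $T=\mathrm{Hom}(P,\mathbb C^\times)$ and $T_{ad}=\mathrm{Hom}(Q,\mathbb C^\times)$ be the maximal tori of the simply connected and of the adjoint group, and let $Z=\ker(T\to T_{ad})$ be the center of the simply connected group. Let $\sigma$ be the cone generated by the fundamental coweights (the basis of $\mathfrak h$ dual to the simple roots). Let $W=\mathrm{Spec}\,\mathbb C[\sigma^\vee\cap P]$ be the toric variety of $T$, and let $W_{ad}=\mathfrak u/[\mathfrak u,\mathfrak u]$, where $\mathfrak u$ is the sum of the positive root spaces. Choose nonzero simple root vectors $X_i\in\mathfrak g_{\alpha_i}$ and regard $W_{ad}$ as the toric variety $\mathrm{Spec}\,\mathbb C[\sigma^\vee\cap Q]$ of $T_{ad}$, the point whose coordinate functions $\alpha_i$ take the values $x_i$ being the class of $\sum_i x_iX_i$. Let $\rho:W\to W_{ad}=W/Z$ be the quotient map induced by $Q\subseteq P$ (on complex points). For $J\subseteq\{1,\dots,n\}$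 let $\tau_J\subseteq W_{ad}$ be the $T_{ad}$-orbit of the class of $\sum_{i\notin J}X_i$. Let $J\subseteq\{1,\dots,n\}$ be nonempty. Over every point $y\in\tau_J$ the fiber $\rho^{-1}(y)$ is nonempty and is a single $Z$-orbit; for every $w\in\rho^{-1}(y)$ the group $Z(J)=Z/\mathrm{Stab}_Z(w)$, which acts simply transitively on this fiber, is, up to isomorphism, as follows. - $A_n$: $Z(J)\cong\mathbb Z/c\mathbb Z$ with $c=\gcd(J\cup\{n+1\})$. - $B_n$: $Z(J)\cong\mathbb Z/2\mathbb Z$ if all $j\in J$ are even, and $Z(J)=\{1\}$ otherwise. - $C_n$: $Z(J)\cong\mathbb Z/2\mathbb Z$ if $n\notin J$, and $Z(J)=\{1\}$ otherwise. - $D_n$ ($n\ge 3$): $Z(J)\cong Z$ if $n-1,n\notin J$ and all $j\in J$ are even; $Z(J)\cong\mathbb Z/2\mathbb Z$ if $n-1,n\notin J$ and not all $j\in J$ are even; $Z(J)\cong\mathbb Z/2\mathbb Z$ if exactly one of $n-1,n$ is in $J$, all $j\in J$ with $j<n-1$ are even, $n$ is even and $n\ge 4$; and $Z(J)=\{1\}$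 otherwise. - $E_6$: $Z(J)\cong\mathbb Z/3\mathbb Z$ if none of $1,3,5,6$ is in $J$, and $Z(J)=\{1\}$ otherwise. - $E_7$: $Z(J)\cong\mathbb Z/2\mathbb Z$ if none of $2,5,7$ is in $J$, and $Z(J)=\{1\}$ otherwise. -/

import Mathlib

/-!
Throughout, `L` is a complex semisimple Lie algebra (Mathlib's class `IsKilling`, which for a finite
dimensional `L` over `ℂ` is the same as being semisimple), `H` a Cartan subalgebra and `b` a base of
the root system of `(L, H)`; the pair `(H, b)` amounts to a choice of a Borel subalgebra together
with a Cartan subalgebra of it.  The simple roots are indexed by `b.support`.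
-/

open LieAlgebra LieAlgebra.IsKilling LieModule Module

noncomputable section

namespace Graham

variable {L : Type*} [LieRing L] [LieAlgebra ℂ L] [FiniteDimensional ℂ L] [IsKilling ℂ L]
  {H : LieSubalgebra ℂ L} [H.IsCartanSubalgebra]

/-! ### Lattices, tori and the center -/

variable (H)

/-- The root lattice: the character lattice of the maximal torus `T_ad` of the adjoint group. -/
def rootLattice : AddSubgroup (Dual ℂ H) :=
  AddSubgroup.closure (Set.range (rootSystem H).root)

/-- The weight lattice (integral on every coroot): the character lattice of the maximal torus `T`
of the simply connected group. -/
def weightLattice : AddSubgroup (Dual ℂ H) where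
  carrier := {μ | ∀ α : H.root, ∃ k : ℤ, μ ((rootSystem H).coroot α) = k}
  zero_mem' _ := ⟨0, by simp⟩
  add_mem' := by
    intro μ ν hμ hν α
    obtain ⟨k, hk⟩ := hμ α
    obtain ⟨l, hl⟩ := hν α
    exact ⟨k + l, by rw [LinearMap.add_apply, hk, hl, Int.cast_add]⟩
  neg_mem' := by
    intro μ hμ α
    obtain ⟨k, hk⟩ := hμ α
    exact ⟨-k, by rw [LinearMap.neg_apply, hk, Int.cast_neg]⟩

theorem rootLattice_le_weightLattice :
    rootLattice H ≤ weightLattice H := by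
  refine (AddSubgroup.closure_le _).2 ?_
  rintro _ ⟨β, rfl⟩ α
  obtain ⟨k, hk⟩ := RootPairing.exists_value (S := ℤ) (P := rootSystem H) β α
  exact ⟨k, hk.symm⟩

/-- The (complex points of the) torus with character lattice `Λ`. -/
abbrev Torus {H : LieSubalgebra ℂ L} (Λ : AddSubgroup (Dual ℂ H)) : Type _ := Multiplicative Λ →* ℂˣ

/-- The inclusion of character lattices. -/
def latticeIncl {H : LieSubalgebra ℂ L} {Λ Λ' : AddSubgroup (Dual ℂ H)} (h : Λ ≤ Λ') :
    Multiplicative Λ →* Multiplicative Λ' :=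
  AddMonoidHom.toMultiplicative (AddSubgroup.inclusion h)

/-- The quotient homomorphism `T → T_ad`, dual to the inclusion of the root lattice in the weight
lattice. -/
def torusProj :
    Torus (weightLattice H) →* Torus (rootLattice H) :=
  MonoidHom.compHom' (latticeIncl (rootLattice_le_weightLattice H))

/-- The center `Z` of the simply connected group: the elements of `T` on which all roots are
trivial, that is, the kernel of `T → T_ad`. -/
def center : Subgroup (Torus (weightLattice H)) :=
  (torusProj H).ker

variable {H}

/-! ### The cone and its toric varieties -/

/-- The fundamental coweights: the elements of `H` dual to the simple roots. -/
def fundCoweight (b : (rootSystem H).Base) (i : b.support) : H :=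
  (evalEquiv ℂ H).symm (b.toWeightBasis.coord i)

theorem apply_fundCoweight (b : (rootSystem H).Base) (i : b.support) (μ : Dual ℂ H) :
    μ (fundCoweight b i) = b.toWeightBasis.coord i μ := by
  simp [fundCoweight]

/-- The cone `σ` in `H` generated by the fundamental coweights. -/
def cone (b : (rootSystem H).Base) : Set H :=
  {x | ∃ c : b.support → ℝ, (∀ i, 0 ≤ c i) ∧ x = ∑ i, (c i : ℂ) • fundCoweight b i}

theorem fundCoweight_mem_cone (b : (rootSystem H).Base) (i : b.support) :
    fundCoweight b i ∈ cone b := by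
  classical
  refine ⟨Pi.single i 1, fun j => ?_, ?_⟩
  · by_cases h : j = i
    · subst h; simp
    · simp [h]
  · rw [Finset.sum_eq_single i] <;> simp +contextual

/-- The semigroup `σ^∨ ∩ Λ` of the lattice points of the dual cone. -/
def coneSemigroup (b : (rootSystem H).Base) (Λ : AddSubgroup (Dual ℂ H)) :
    AddSubmonoid (Dual ℂ H) where
  carrier := {μ | μ ∈ Λ ∧ ∀ x ∈ cone b, ∃ r : ℝ, 0 ≤ r ∧ μ x = r}
  zero_mem' := ⟨Λ.zero_mem, fun _ _ => ⟨0, by simp⟩⟩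
  add_mem' := by
    rintro μ ν ⟨hμ, hμ'⟩ ⟨hν, hν'⟩
    refine ⟨Λ.add_mem hμ hν, fun x hx => ?_⟩
    obtain ⟨r, hr, h⟩ := hμ' x hx
    obtain ⟨s, hs, h'⟩ := hν' x hx
    exact ⟨r + s, add_nonneg hr hs, by simp [h, h']⟩

/-- The points of the affine toric variety `Spec ℂ[σ^∨ ∩ Λ]`, as semigroup homomorphisms from
`σ^∨ ∩ Λ` to the multiplicative monoid `ℂ`. The number `w.eval μ` is the value at the point `w` of
the monomial function with exponent `μ`. -/
@[ext]
structure ToricVariety (b : (rootSystem H).Base) (Λ : AddSubgroup (Dual ℂ H)) where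
  /-- the values of the monomial functions -/
  eval : coneSemigroup b Λ → ℂ
  eval_zero : eval 0 = 1
  eval_add : ∀ μ ν, eval (μ + ν) = eval μ * eval ν

/-- The value of the character `μ ∈ σ^∨ ∩ Λ` on an element of the torus. -/
def charVal (b : (rootSystem H).Base) {Λ : AddSubgroup (Dual ℂ H)} (t : Torus Λ)
    (μ : coneSemigroup b Λ) : ℂ :=
  (t (Multiplicative.ofAdd ⟨(μ : Dual ℂ H), μ.2.1⟩) : ℂˣ)

/-- The action of the torus on its toric variety: `(t • w)(μ) = t(μ) w(μ)`. -/
instance (b : (rootSystem H).Base) (Λ : AddSubgroup (Dual ℂ H)) :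
    MulAction (Torus Λ) (ToricVariety b Λ) where
  smul t w :=
    { eval := fun μ => charVal b t μ * w.eval μ
      eval_zero := by
        have h : charVal b t 0 = 1 := congrArg Units.val (map_one t)
        rw [h, w.eval_zero, one_mul]
      eval_add := fun μ ν => by
        have h : charVal b t (μ + ν) = charVal b t μ * charVal b t ν :=
          congrArg Units.val (map_mul t
            (Multiplicative.ofAdd (⟨(μ : Dual ℂ H), μ.2.1⟩ : Λ))
            (Multiplicative.ofAdd (⟨(ν : Dual ℂ H), ν.2.1⟩ : Λ)))
        rw [h, w.eval_add, mul_mul_mul_comm] }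
  one_smul w := ToricVariety.ext (funext fun _ => one_mul _)
  mul_smul t s w := ToricVariety.ext (funext fun μ => mul_assoc _ _ _)

/-- Graham's toric variety `W` for the torus `T`. -/
abbrev W (b : (rootSystem H).Base) : Type _ := ToricVariety b (weightLattice H)

/-- The toric variety for `T_ad`. -/
abbrev ToricAd (b : (rootSystem H).Base) : Type _ := ToricVariety b (rootLattice H)

/-- The inclusion of `σ^∨ ∩ rootLattice` in `σ^∨ ∩ weightLattice`. -/
def semigroupIncl (b : (rootSystem H).Base) :
    coneSemigroup b (rootLattice H) →+ coneSemigroup b (weightLattice H) :=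
  AddSubmonoid.inclusion fun _ h => ⟨rootLattice_le_weightLattice H h.1, h.2⟩

/-- The quotient by `Z`: the toric morphism dual to the inclusion
`ℂ[σ^∨ ∩ rootLattice] ⊆ ℂ[σ^∨ ∩ weightLattice]`. -/
def toricQuot (b : (rootSystem H).Base) (w : W b) : ToricAd b where
  eval μ := w.eval (semigroupIncl b μ)
  eval_zero := by rw [map_zero, w.eval_zero]
  eval_add μ ν := by rw [map_add, w.eval_add]

open Classical in
/-- The distinguished point for the face of `σ` spanned by the `fundCoweight b j`, `j ∈ J`: it is
`1` on the part of `σ^∨ ∩ rootLattice` orthogonal to this face (generated by the simple roots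
outside `J`), and `0` elsewhere. -/
def distinguishedPoint (b : (rootSystem H).Base) (J : Set b.support) : ToricAd b where
  eval μ := if ∀ j ∈ J, (μ : Dual ℂ H) (fundCoweight b j) = 0 then 1 else 0
  eval_zero := if_pos fun _ _ => rfl
  eval_add μ ν := by
    have key : (∀ j ∈ J, ((μ + ν : coneSemigroup b _) : Dual ℂ H) (fundCoweight b j) = 0) ↔
        (∀ j ∈ J, (μ : Dual ℂ H) (fundCoweight b j) = 0) ∧
        (∀ j ∈ J, (ν : Dual ℂ H) (fundCoweight b j) = 0) := by
      rw [← forall₂_and]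
      refine forall₂_congr fun j _ => ?_
      obtain ⟨r, hr, h⟩ := μ.2.2 _ (fundCoweight_mem_cone b j)
      obtain ⟨s, hs, h'⟩ := ν.2.2 _ (fundCoweight_mem_cone b j)
      rw [AddSubmonoid.coe_add, LinearMap.add_apply, h, h']
      norm_cast
      exact add_eq_zero_iff_of_nonneg hr hs
    rw [if_congr key rfl rfl, ite_and, ite_mul, one_mul, zero_mul]

/-- A simple root lies in the cone semigroup of the root lattice. -/
theorem root_mem_coneSemigroup (b : (rootSystem H).Base) (i : b.support) :
    (rootSystem H).root i ∈ coneSemigroup b (rootLattice H) := by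
  classical
  refine ⟨AddSubgroup.subset_closure ⟨_, rfl⟩, ?_⟩
  rintro _ ⟨c, hc, rfl⟩
  refine ⟨c i, hc i, ?_⟩
  rw [map_sum, Finset.sum_eq_single i]
  · rw [map_smul, apply_fundCoweight, Basis.coord_apply, b.toWeightBasis_repr_root]
    simp
  · intro j _ hj
    rw [map_smul, apply_fundCoweight, Basis.coord_apply, b.toWeightBasis_repr_root]
    simp [hj]
  · simp

/-! ### The space `W_ad = 𝔲 / [𝔲, 𝔲]` -/

/-- The nilradical `𝔲` of the Borel subalgebra: the sum of the positive root spaces. -/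
def nilradical (b : (rootSystem H).Base) : Submodule ℂ L :=
  ⨆ α : H.root, ⨆ _ : b.IsPos α, (rootSpace H (α : Weight ℂ H L)).toSubmodule

/-- The derived algebra `[𝔲, 𝔲]`, as a subspace of `𝔲`. -/
def derivedNilradical (b : (rootSystem H).Base) : Submodule ℂ (nilradical b) :=
  (Submodule.span ℂ {z : L | ∃ x ∈ nilradical b, ∃ y ∈ nilradical b, ⁅x, y⁆ = z}).comap
    (nilradical b).subtype

/-- `W_ad = 𝔲 / [𝔲, 𝔲]`. -/
abbrev Wad (b : (rootSystem H).Base) : Type _ := nilradical b ⧸ derivedNilradical b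

/-- A choice of a nonzero root vector for every simple root. -/
structure SimpleRootVectors (b : (rootSystem H).Base) where
  /-- the root vectors -/
  vec : b.support → L
  mem_rootSpace : ∀ i : b.support, vec i ∈ rootSpace H ((i : H.root) : Weight ℂ H L)
  ne_zero : ∀ i, vec i ≠ 0

theorem SimpleRootVectors.mem_nilradical {b : (rootSystem H).Base} (X : SimpleRootVectors b)
    (i : b.support) : X.vec i ∈ nilradical b := by
  have hi : b.IsPos i := by
    rw [RootPairing.Base.isPos_iff, RootPairing.Base.height_one_of_mem_support i.2]
    exact one_pos
  exact Submodule.mem_iSup_of_mem (i : H.root)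
    (Submodule.mem_iSup_of_mem hi (X.mem_rootSpace i))

/-- The class of the chosen simple root vector in `W_ad`. -/
def SimpleRootVectors.cls {b : (rootSystem H).Base} (X : SimpleRootVectors b) (i : b.support) :
    Wad b :=
  (derivedNilradical b).mkQ ⟨X.vec i, X.mem_nilradical i⟩

/-- The toric structure on `W_ad = 𝔲 / [𝔲, 𝔲]`, relative to a choice of simple root vectors: the
simple roots generate `σ^∨ ∩ rootLattice`, their monomials are the coordinates of the toric variety,
and the point with coordinates `(xᵢ)` corresponds to the class of `∑ xᵢ Xᵢ`.  An element `t` of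
`T_ad` acts on the class of `Xᵢ` through the scalar `t(αᵢ)`. -/
def toricChart {b : (rootSystem H).Base} (X : SimpleRootVectors b) (x : ToricAd b) : Wad b :=
  ∑ i : b.support, x.eval ⟨_, root_mem_coneSemigroup b i⟩ • X.cls i

/-- The quotient map `ρ : W → W_ad`. -/
def rho {b : (rootSystem H).Base} (X : SimpleRootVectors b) (w : W b) : Wad b :=
  toricChart X (toricQuot b w)

/-- The `T_ad`-orbit `τ_J` in `W_ad`; it contains the class of `∑_{i ∉ J} Xᵢ`. -/
def tau {b : (rootSystem H).Base} (X : SimpleRootVectors b) (J : Set b.support) : Set (Wad b) :=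
  toricChart X '' MulAction.orbit (Torus (rootLattice H)) (distinguishedPoint b J)

/-- `Z(J)` is (isomorphic to) the group `A`: over every point of `τ_J` the fiber of `ρ` is nonempty,
it is a single `Z`-orbit, and the group `Z / Stab_Z(w)`, which acts simply transitively on it, is
isomorphic to `A`. -/
def FiberGroupIs {b : (rootSystem H).Base} (X : SimpleRootVectors b) (J : Set b.support)
    (A : Type*) [Group A] : Prop :=
  ∀ y ∈ tau X J, (rho X ⁻¹' {y}).Nonempty ∧ ∀ w ∈ rho X ⁻¹' {y},
    rho X ⁻¹' {y} = MulAction.orbit (center H) w ∧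
    Nonempty ((center H ⧸ MulAction.stabilizer (center H) w) ≃* A)

/-- The numbering `e` of the simple roots identifies the Cartan matrix `⟨αᵢ, αⱼ^∨⟩` with `C`. -/
def HasCartanMatrix (b : (rootSystem H).Base) {n : ℕ} (C : Matrix (Fin n) (Fin n) ℤ)
    (e : Fin n ≃ b.support) : Prop :=
  ∀ i j, b.cartanMatrix (e i) (e j) = C i j

/-- The set of simple roots `α_j`, `j ∈ J`, where `J ⊆ {1, …, n}` and `α_{i+1}` is `e i`. -/
def simpleRootsOf (b : (rootSystem H).Base) {n : ℕ} (e : Fin n ≃ b.support) (J : Finset ℕ) :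
    Set b.support :=
  {i | (e.symm i : ℕ) + 1 ∈ J}

end Graham

end

/-! The fiber group is computed by duality. Restriction of characters identifies the center `Z` with
the dual of `P/Q`. Let `w` lie over a point of `τ_J`. Some multiple of every weight lies in `Q`, so
the monomials not vanishing at `w` are exactly those whose weight has zero `α_j`-coefficient for all
`j ∈ J` (`eval_ne_zero_iff`). Hence an element of `Z` fixes `w` iff it is trivial on the subgroup of
`P/Q` given by these weights (`stabilizer_eq_ker`).

Writing weights in the basis of simple roots and reducing coefficients modulo `ℤ` embeds `P/Q` in
`(ℂ/ℤ)ⁿ = (ℂˣ)ⁿ` as the kernel of the transposed Cartan matrix; the subgroup in question is cut out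
by `u_j = 0` for `j ∈ J`. This is `classGroup b J`. Since `ℂˣ` is divisible, each character of it
extends to one of `P/Q` (`centerRestrict_surjective`). So `Z / Stab_Z(w)` is the character group of
`classGroup b J`, and any two points of a fiber differ by an element of `Z`, their ratio being such
a character (`exists_smul_eq`). Fibers in `W_ad` are fibers of toric varieties because the classes
of the simple root vectors are independent modulo `[𝔲, 𝔲]` (`toricChart_injective`).

It remains to solve the Cartan equations over `ℂ/ℤ`. Along a simply laced chain they say that second
differences vanish, so `f k = k • f 1`; the end of the diagram then imposes torsion. Types `E₆` and
`E₇` are finite linear algebra. The answer is trivial, cyclic (one coordinate embeds the group onto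
the `c`-th roots of unity), or all of `Z`. -/

noncomputable section

namespace Graham

variable {L : Type*} [LieRing L] [LieAlgebra ℂ L] [FiniteDimensional ℂ L] [IsKilling ℂ L]
  {H : LieSubalgebra ℂ L} [H.IsCartanSubalgebra]

section Lattices

/-! ### The exponential `ℂ → ℂˣ` and divisibility of `ℂˣ` -/

/-- The group `ℂˣ`, written additively. -/
def AddUnits : Type := Additive ℂˣ

instance : AddCommGroup AddUnits := inferInstanceAs (AddCommGroup (Additive ℂˣ))

/-- The homomorphism `z ↦ exp (2πiz)`, with kernel `ℤ`. -/
def expHom : ℂ →+ AddUnits where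
  toFun z := Additive.ofMul (Units.mk0 (Complex.exp (2 * Real.pi * Complex.I * z))
    (Complex.exp_ne_zero _))
  map_zero' := by
    change Additive.ofMul _ = Additive.ofMul 1
    congr 1
    ext
    simp
  map_add' z w := by
    change Additive.ofMul _ = Additive.ofMul (_ * _)
    congr 1
    ext
    simp [mul_add, Complex.exp_add]

theorem expHom_eq_zero_iff (z : ℂ) : expHom z = 0 ↔ ∃ k : ℤ, z = k := by
  have h : expHom z = 0 ↔ Complex.exp (2 * Real.pi * Complex.I * z) = 1 := by
    change Units.mk0 _ (Complex.exp_ne_zero _) = (1 : ℂˣ) ↔ _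
    rw [Units.ext_iff]
    rfl
  rw [h, Complex.exp_eq_one_iff]
  refine exists_congr fun k => ?_
  have := Complex.two_pi_I_ne_zero
  rw [mul_comm]
  exact ⟨fun h => mul_right_cancel₀ this h, fun h => by rw [h]⟩

theorem expHom_surjective : Function.Surjective expHom := by
  intro u
  refine ⟨Complex.log ((Additive.toMul u : ℂˣ) : ℂ) / (2 * Real.pi * Complex.I), ?_⟩
  apply (Additive.toMul (α := ℂˣ)).injective
  ext
  change Complex.exp _ = _
  rw [mul_div_cancel₀ _ Complex.two_pi_I_ne_zero, Complex.exp_log (Units.ne_zero _)]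

/-- A torsion class in `ℂ/ℤ` has a rational representative `k / N`, whose fractional part is
nonnegative. This is what moves a class of weights into the dual cone. -/
theorem exists_nonneg_expHom_eq {N : ℕ} (hN : N ≠ 0) {u : AddUnits} (hu : N • u = 0) :
    ∃ r : ℝ, 0 ≤ r ∧ expHom r = u := by
  obtain ⟨z, rfl⟩ := expHom_surjective u
  rw [← map_nsmul, expHom_eq_zero_iff] at hu
  obtain ⟨k, hk⟩ := hu
  have hz : z = ((k / N : ℝ) : ℂ) := by
    have : (N : ℂ) ≠ 0 := Nat.cast_ne_zero.2 hN
    push_cast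
    field_simp
    rw [← hk, nsmul_eq_mul, mul_comm]
  refine ⟨Int.fract (k / N : ℝ), Int.fract_nonneg _, ?_⟩
  rw [hz, ← sub_eq_zero, ← map_sub, expHom_eq_zero_iff]
  refine ⟨-⌊(k / N : ℝ)⌋, ?_⟩
  rw [Int.fract]
  push_cast
  ring

/-- Divisible abelian groups are injective, by Baer's criterion. -/
theorem exists_monoidHom_extension {A B : Type*} [AddCommGroup A] [AddCommGroup B] (f : A →+ B)
    (hf : Function.Injective f) (g : A →+ AddUnits) : ∃ h : B →+ AddUnits, h.comp f = g := by
  have : ∀ {n : ℤ} (u : AddUnits), n ≠ 0 → ∃ v, n • v = u := by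
    intro n u hn
    obtain ⟨z, rfl⟩ := expHom_surjective u
    refine ⟨expHom (z / n), ?_⟩
    rw [← map_zsmul, zsmul_eq_mul, mul_div_cancel₀ _ (Int.cast_ne_zero.2 hn)]
  let : DivisibleBy (AddUnits) ℤ := divisibleByOfSMulRightSurj _ _
    fun hn u => this u hn
  exact (Module.Baer.of_divisible (AddUnits)).extension_property_addMonoidHom f hf g

/-! ### Coordinates with respect to the simple roots -/

variable (b : (rootSystem H).Base)

/-- The coefficient of the `i`-th simple root. -/
abbrev coord (i : b.support) : Dual ℂ H →ₗ[ℂ] ℂ := b.toWeightBasis.coord i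

/-- The simple roots. -/
abbrev simpleRoot (i : b.support) : Dual ℂ H := (rootSystem H).root i

theorem sum_coord_smul (μ : Dual ℂ H) : ∑ i, coord b i μ • simpleRoot b i = μ := by
  have h := b.toWeightBasis.sum_repr μ
  simp only [b.toWeightBasis_apply] at h
  exact h

open Classical in
theorem coord_simpleRoot (i j : b.support) : coord b i (simpleRoot b j) = if i = j then 1 else 0 :=
    by
  rw [Basis.coord_apply, b.toWeightBasis_repr_root, Finsupp.single_apply]
  exact if_congr eq_comm rfl rfl

open Classical in
theorem coord_sum_smul (c : b.support → ℂ) (i : b.support) :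
    coord b i (∑ j, c j • simpleRoot b j) = c i := by
  simp only [map_sum, map_smul, coord_simpleRoot]
  simp

theorem simpleRoot_mem_rootLattice (i : b.support) : simpleRoot b i ∈ rootLattice H :=
  AddSubgroup.subset_closure ⟨_, rfl⟩

theorem mem_rootLattice_iff (μ : Dual ℂ H) :
    μ ∈ rootLattice H ↔ ∀ i, ∃ k : ℤ, coord b i μ = k := by
  constructor
  · intro h i
    induction h using AddSubgroup.closure_induction with
    | mem x hx =>
      obtain ⟨α, rfl⟩ := hx
      obtain ⟨f, -, -, hf⟩ := b.exists_root_eq_sum_int α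
      refine ⟨f i, ?_⟩
      rw [hf, ← Finset.sum_coe_sort]
      rw [← coord_sum_smul b (fun j => (f j : ℂ)) i]
      simp only [Int.cast_smul_eq_zsmul]
    | zero => exact ⟨0, by simp⟩
    | add x y _ _ hx hy =>
      obtain ⟨k, hk⟩ := hx
      obtain ⟨l, hl⟩ := hy
      exact ⟨k + l, by rw [map_add, hk, hl, Int.cast_add]⟩
    | neg x _ hx =>
      obtain ⟨k, hk⟩ := hx
      exact ⟨-k, by rw [map_neg, hk, Int.cast_neg]⟩
  · intro h
    choose k hk using h
    rw [← sum_coord_smul b μ]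
    refine sum_mem fun i _ => ?_
    rw [hk, Int.cast_smul_eq_zsmul]
    exact zsmul_mem (simpleRoot_mem_rootLattice b i) _

theorem apply_coroot_eq (μ : Dual ℂ H) (j : b.support) :
    μ ((rootSystem H).coroot j) = ∑ i, (b.cartanMatrix i j : ℂ) * coord b i μ := by
  conv_lhs => rw [← sum_coord_smul b μ]
  rw [LinearMap.sum_apply]
  refine Finset.sum_congr rfl fun i _ => ?_
  rw [LinearMap.smul_apply, smul_eq_mul, mul_comm]
  congr 1
  exact (b.algebraMap_cartanMatrixIn_apply ℤ i j).symm

/-- Integrality on the simple coroots suffices, since they span all coroots over `ℤ`. -/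
theorem mem_weightLattice_iff (μ : Dual ℂ H) :
    μ ∈ weightLattice H ↔ ∀ j, ∃ k : ℤ, ∑ i, (b.cartanMatrix i j : ℂ) * coord b i μ = k := by
  simp_rw [← apply_coroot_eq]
  refine ⟨fun h j => h j, fun h α => ?_⟩
  have hα := b.coroot_mem_span_int α
  generalize (rootSystem H).coroot α = x at hα
  induction hα using Submodule.span_induction with
  | mem x hx =>
    obtain ⟨j, hj, rfl⟩ := hx
    exact h ⟨j, hj⟩
  | zero => exact ⟨0, by simp⟩
  | add x y _ _ hx hy =>
    obtain ⟨k, hk⟩ := hx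
    obtain ⟨l, hl⟩ := hy
    exact ⟨k + l, by rw [map_add, hk, hl, Int.cast_add]⟩
  | smul a x _ hx =>
    obtain ⟨k, hk⟩ := hx
    exact ⟨a * k, by rw [map_zsmul, hk, zsmul_eq_mul, Int.cast_mul]⟩

/-- Multiplying the equations by the adjugate of the Cartan matrix shows that its nonzero
determinant kills every solution; `N` is the absolute value of this determinant. -/
theorem exists_smul_eq_zero :
    ∃ N : ℕ, N ≠ 0 ∧ ∀ u : b.support → AddUnits,
      (∀ j, ∑ i, b.cartanMatrix i j • u i = 0) → ∀ i, N • u i = 0 := by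
  classical
  have hdet := (Matrix.nondegenerate_iff_det_ne_zero.1 b.cartanMatrix_nondegenerate)
  refine ⟨b.cartanMatrix.det.natAbs, Int.natAbs_ne_zero.2 hdet, fun u hu i => ?_⟩
  have h : b.cartanMatrix.det • u i = 0 := by
    have : ∑ j, b.cartanMatrix.adjugate j i • ∑ k, b.cartanMatrix k j • u k = 0 :=
      Finset.sum_eq_zero fun j _ => by rw [hu, smul_zero]
    simp_rw [Finset.smul_sum, smul_smul] at this
    rw [Finset.sum_comm] at this
    simp_rw [← Finset.sum_smul, mul_comm (b.cartanMatrix.adjugate _ _), ← Matrix.mul_apply,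
      Matrix.mul_adjugate, Matrix.smul_apply, Matrix.one_apply] at this
    simpa using this
  rw [← natCast_zsmul]
  rcases Int.natAbs_eq b.cartanMatrix.det with h' | h'
  · rwa [← h']
  · rw [h', neg_smul, neg_eq_zero] at h
    exact h

/-- The coordinates of a weight modulo integers, in `ℂ / ℤ = ℂˣ`. -/
def coordMod : Dual ℂ H →+ (b.support → AddUnits) :=
  AddMonoidHom.mk' (fun μ i => expHom (coord b i μ)) fun μ ν => by
    funext i
    rw [Pi.add_apply, map_add, map_add]

theorem coordMod_apply (μ : Dual ℂ H) (i : b.support) : coordMod b μ i = expHom (coord b i μ) := rfl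

theorem coordMod_eq_zero_iff (μ : Dual ℂ H) : coordMod b μ = 0 ↔ μ ∈ rootLattice H := by
  rw [mem_rootLattice_iff b, funext_iff]
  exact forall_congr' fun i => expHom_eq_zero_iff _

theorem sum_smul_coordMod (μ : Dual ℂ H) (j : b.support) :
    ∑ i, b.cartanMatrix i j • coordMod b μ i
      = expHom (∑ i, (b.cartanMatrix i j : ℂ) * coord b i μ) := by
  rw [map_sum]
  refine Finset.sum_congr rfl fun i _ => ?_
  rw [coordMod_apply, ← map_zsmul, zsmul_eq_mul]

theorem mem_weightLattice_iff_coordMod (μ : Dual ℂ H) :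
    μ ∈ weightLattice H ↔ ∀ j, ∑ i, b.cartanMatrix i j • coordMod b μ i = 0 := by
  simp_rw [sum_smul_coordMod, expHom_eq_zero_iff, mem_weightLattice_iff b]

theorem mem_coneSemigroup_iff (Λ : AddSubgroup (Dual ℂ H)) (μ : Dual ℂ H) :
    μ ∈ coneSemigroup b Λ ↔ μ ∈ Λ ∧ ∀ i, ∃ r : ℝ, 0 ≤ r ∧ coord b i μ = r := by
  refine and_congr_right fun _ => ⟨fun h i => ?_, fun h => ?_⟩
  · rw [← apply_fundCoweight]
    exact h _ (fundCoweight_mem_cone b i)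
  · rintro _ ⟨c, hc, rfl⟩
    choose r hr hμ using h
    refine ⟨∑ i, c i * r i, Finset.sum_nonneg fun i _ => mul_nonneg (hc i) (hr i), ?_⟩
    rw [map_sum]
    push_cast
    refine Finset.sum_congr rfl fun i _ => ?_
    rw [map_smul, apply_fundCoweight, smul_eq_mul, ← hμ]

/-- The group of the elements of `(ℂ / ℤ)ⁿ` whose pairings with the simple coroots vanish, and whose
coordinates in `J` vanish.  For `J = ∅` it is the quotient of the weight lattice by the root
lattice. -/
def classGroup (J : Set b.support) : AddSubgroup (b.support → AddUnits) where
  carrier := {u | (∀ j, ∑ i, b.cartanMatrix i j • u i = 0) ∧ ∀ j ∈ J, u j = 0}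
  zero_mem' := by simp
  add_mem' := by
    rintro u v ⟨hu, hu'⟩ ⟨hv, hv'⟩
    refine ⟨fun j => ?_, fun j hj => ?_⟩
    · simp only [Pi.add_apply, smul_add, Finset.sum_add_distrib, hu, hv, add_zero]
    · rw [Pi.add_apply, hu' j hj, hv' j hj, add_zero]
  neg_mem' := by
    rintro u ⟨hu, hu'⟩
    refine ⟨fun j => ?_, fun j hj => ?_⟩
    · simp only [Pi.neg_apply, smul_neg, Finset.sum_neg_distrib, hu, neg_zero]
    · rw [Pi.neg_apply, hu' j hj, neg_zero]

theorem exists_coneSemigroup_lift {J : Set b.support} {u : b.support → AddUnits}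
    (hu : u ∈ classGroup b J) :
    ∃ μ : coneSemigroup b (weightLattice H), coordMod b μ = u ∧ ∀ j ∈ J, coord b j μ = 0 := by
  classical
  obtain ⟨N, hN, h⟩ := exists_smul_eq_zero b
  choose r hr hru using fun i => exists_nonneg_expHom_eq hN (h u hu.1 i)
  -- For `i ∈ J` the class `u i` vanishes, so the representative may be taken to be exactly `0`,
  -- which puts the weight on the face orthogonal to `J`.
  let c : b.support → ℝ := fun i => if i ∈ J then 0 else r i
  have hc : coordMod b (∑ i, (c i : ℂ) • simpleRoot b i) = u := by
    funext i
    rw [coordMod_apply, coord_sum_smul]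
    by_cases hi : i ∈ J
    · simp [c, hi, hu.2 i hi]
    · simp [c, hi, hru]
  refine ⟨⟨∑ i, (c i : ℂ) • simpleRoot b i, (mem_coneSemigroup_iff b _ _).2 ⟨?_, fun i => ⟨c i, ?_,
      ?_⟩⟩⟩,
    hc, fun j hj => ?_⟩
  · rw [mem_weightLattice_iff_coordMod b, hc]
    exact hu.1
  · by_cases hi : i ∈ J <;> simp [c, hi, hr]
  · rw [coord_sum_smul]
  · rw [coord_sum_smul]
    simp [c, hj]

theorem exists_nsmul_mem_rootLattice (b : (rootSystem H).Base) :
    ∃ N : ℕ, N ≠ 0 ∧ ∀ μ ∈ weightLattice H, N • μ ∈ rootLattice H := by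
  obtain ⟨N, hN, h⟩ := exists_smul_eq_zero b
  refine ⟨N, hN, fun μ hμ => ?_⟩
  rw [← coordMod_eq_zero_iff b, map_nsmul]
  funext i
  exact h _ ((mem_weightLattice_iff_coordMod b μ).1 hμ) i

end Lattices

section Chart

/-! ### The chart of `W_ad` is injective -/

namespace ToricVariety

variable {b : (rootSystem H).Base} {Λ : AddSubgroup (Dual ℂ H)}

/-- A point of a toric variety, as a monoid homomorphism. -/
def toMonoidHom (x : ToricVariety b Λ) : Multiplicative (coneSemigroup b Λ) →* ℂ where
  toFun μ := x.eval μ.toAdd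
  map_one' := x.eval_zero
  map_mul' μ ν := x.eval_add μ.toAdd ν.toAdd

theorem eval_nsmul (x : ToricVariety b Λ) (n : ℕ) (μ : coneSemigroup b Λ) :
    x.eval (n • μ) = x.eval μ ^ n :=
  map_pow x.toMonoidHom (Multiplicative.ofAdd μ) n

theorem eval_sum (x : ToricVariety b Λ) {ι : Type*} (s : Finset ι) (f : ι → coneSemigroup b Λ) :
    x.eval (∑ i ∈ s, f i) = ∏ i ∈ s, x.eval (f i) := by
  have h := map_prod x.toMonoidHom (fun i => Multiplicative.ofAdd (f i)) s
  rwa [← ofAdd_sum] at h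

end ToricVariety

variable (b : (rootSystem H).Base)

/-- On the root lattice the coordinates are integers, and on the dual cone nonnegative reals. A
point of the adjoint toric variety is therefore determined by its values at the simple roots. -/
theorem exists_eq_sum_nsmul (μ : coneSemigroup b (rootLattice H)) :
    ∃ n : b.support → ℕ, μ = ∑ i, n i • ⟨simpleRoot b i, root_mem_coneSemigroup b i⟩ := by
  obtain ⟨h, h'⟩ := (mem_coneSemigroup_iff b _ _).1 μ.2
  have key : ∀ i, ∃ n : ℕ, coord b i μ = n := by
    intro i
    obtain ⟨k, hk⟩ := (mem_rootLattice_iff b _).1 h i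
    obtain ⟨r, hr, hr'⟩ := h' i
    have hkr : (k : ℝ) = r := by exact_mod_cast hk.symm.trans hr'
    rw [← hkr] at hr
    obtain ⟨n, rfl⟩ := Int.eq_ofNat_of_zero_le (Int.cast_nonneg_iff.1 hr)
    exact ⟨n, by simpa using hk⟩
  choose n hn using key
  refine ⟨n, Subtype.ext ?_⟩
  rw [AddSubmonoid.coe_finsetSum]
  conv_lhs => rw [← sum_coord_smul b (μ : Dual ℂ H)]
  refine Finset.sum_congr rfl fun i _ => ?_
  rw [hn, Nat.cast_smul_eq_nsmul]
  rfl

variable {b}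

theorem toricAd_ext {x y : ToricAd b}
    (h : ∀ i, x.eval ⟨_, root_mem_coneSemigroup b i⟩ = y.eval ⟨_, root_mem_coneSemigroup b i⟩) :
    x = y := by
  refine ToricVariety.ext (funext fun μ => ?_)
  obtain ⟨n, rfl⟩ := exists_eq_sum_nsmul b μ
  simp_rw [ToricVariety.eval_sum, ToricVariety.eval_nsmul, h]

/-- The linear form on `𝔥^*` taking the value `1` on all simple roots. -/
def heightForm (b : (rootSystem H).Base) : Dual ℂ H →ₗ[ℂ] ℂ := ∑ i, coord b i

theorem heightForm_simpleRoot (i : b.support) : heightForm b (simpleRoot b i) = 1 := by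
  classical
  rw [heightForm, LinearMap.sum_apply]
  simp only [coord_simpleRoot]
  simp

theorem heightForm_root (α : H.root) :
    heightForm b ((rootSystem H).root α) = b.height α := by
  obtain ⟨f, -, -, hf⟩ := b.exists_root_eq_sum_int α
  rw [RootPairing.Base.height_eq_sum hf, hf, map_sum, Int.cast_sum]
  refine Finset.sum_congr rfl fun j hj => ?_
  rw [map_zsmul, heightForm_simpleRoot ⟨j, hj⟩, zsmul_one]

/-- The sum of the root spaces that are not those of simple roots. -/
def nonsimplePart (b : (rootSystem H).Base) : Submodule ℂ L :=
  ⨆ χ : H → ℂ, ⨆ _ : ∀ i : b.support, χ ≠ simpleRoot b i, (rootSpace H χ).toSubmodule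

/-- Positive roots have height at least `1` and heights add, so a bracket of two positive root
vectors has a weight of height at least `2`. That weight need not be a root, hence the indexing of
`nonsimplePart` by arbitrary functions. -/
theorem lie_mem_nonsimplePart {x y : L} (hx : x ∈ nilradical b) (hy : y ∈ nilradical b) :
    ⁅x, y⁆ ∈ nonsimplePart b := by
  have base : ∀ α β : H.root, b.IsPos α → b.IsPos β → ∀ x ∈ rootSpace H (α : Weight ℂ H L),
      ∀ y ∈ rootSpace H (β : Weight ℂ H L), ⁅x, y⁆ ∈ nonsimplePart b := by
    intro α β hα hβ x hx y hy
    refine Submodule.mem_iSup_of_mem _ (Submodule.mem_iSup_of_mem (fun i hi => ?_)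
      (lie_mem_genWeightSpace_of_mem_genWeightSpace hx hy))
    have h : (rootSystem H).root α + (rootSystem H).root β = simpleRoot b i :=
      LinearMap.ext fun z => congrFun hi z
    have h' := congrArg (heightForm b) h
    rw [map_add, heightForm_root, heightForm_root, heightForm_simpleRoot] at h'
    have h'' : b.height α + b.height β = 1 := by exact_mod_cast h'
    rw [RootPairing.Base.isPos_iff] at hα hβ
    omega
  rw [nilradical] at hx hy
  induction hx using Submodule.iSup_induction' with
  | zero => simp
  | add x x' _ _ hx hx' => rw [add_lie]; exact add_mem hx hx'
  | mem α x hx =>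
  rw [Submodule.mem_iSup] at hx
  by_cases hα : b.IsPos α
  swap
  -- The inner supremum runs over proofs of positivity; without any it is `⊥`.
  · have : x = 0 := by simpa using hx ⊥ fun h => absurd h hα
    simp [this]
  replace hx : x ∈ rootSpace H (α : Weight ℂ H L) := hx _ fun _ => le_rfl
  induction hy using Submodule.iSup_induction' with
  | zero => simp
  | add y y' _ _ hy hy' => rw [lie_add]; exact add_mem hy hy'
  | mem β y hy =>
  rw [Submodule.mem_iSup] at hy
  by_cases hβ : b.IsPos β
  swap
  · have : y = 0 := by simpa using hy ⊥ fun h => absurd h hβ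
    simp [this]
  exact base α β hα hβ x hx y (hy _ fun _ => le_rfl)

variable (X : SimpleRootVectors b)

/-- A linear relation modulo `[𝔲, 𝔲]` places `g i • X.vec i` in the sum of the weight spaces other
than that of `αᵢ`. Independence of the weight spaces makes it zero. -/
theorem linearIndependent_cls : LinearIndependent ℂ X.cls := by
  classical
  rw [Fintype.linearIndependent_iff]
  intro g hg i
  have hmem : ∑ j, g j • X.vec j ∈ nonsimplePart b := by
    have h : (derivedNilradical b).mkQ (∑ j, g j • ⟨X.vec j, X.mem_nilradical j⟩) = 0 := by
      rw [map_sum]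
      simp_rw [map_smul]
      exact hg
    rw [Submodule.mkQ_apply, Submodule.Quotient.mk_eq_zero] at h
    have h' : ((∑ j, g j • ⟨X.vec j, X.mem_nilradical j⟩ : nilradical b) : L) ∈
        Submodule.span ℂ {z : L | ∃ x ∈ nilradical b, ∃ y ∈ nilradical b, ⁅x, y⁆ = z} := h
    have hle : Submodule.span ℂ {z : L | ∃ x ∈ nilradical b, ∃ y ∈ nilradical b, ⁅x, y⁆ = z} ≤
        nonsimplePart b := by
      rw [Submodule.span_le]
      rintro _ ⟨x, hx, y, hy, rfl⟩
      exact lie_mem_nonsimplePart hx hy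
    have h'' := hle h'
    simpa using h''
  let χ : H → ℂ := simpleRoot b i
  let V : Submodule ℂ L := ⨆ ψ : H → ℂ, ⨆ _ : ψ ≠ χ, (rootSpace H ψ).toSubmodule
  have hV : nonsimplePart b ≤ V :=
    iSup_mono fun ψ => iSup_mono' fun h => ⟨h i, le_rfl⟩
  have hother : ∀ j, j ≠ i → X.vec j ∈ V := by
    intro j hj
    refine Submodule.mem_iSup_of_mem (simpleRoot b j : H → ℂ) (Submodule.mem_iSup_of_mem ?_
      (X.mem_rootSpace j))
    intro h
    exact hj (Subtype.ext ((rootSystem H).root.injective (DFunLike.coe_injective h)))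
  have hi : g i • X.vec i ∈ V := by
    have h := V.sub_mem (hV hmem) (V.sum_mem (t := Finset.univ.erase i)
      fun j hj => V.smul_mem (g j) (hother j (Finset.ne_of_mem_erase hj)))
    rwa [← Finset.add_sum_erase _ _ (Finset.mem_univ i), add_sub_cancel_right] at h
  have hind := (LieSubmodule.iSupIndep_toSubmodule.2 (iSupIndep_genWeightSpace ℂ H L)) χ
  have h0 := Submodule.disjoint_def.1 hind (g i • X.vec i)
    (Submodule.smul_mem _ _ (X.mem_rootSpace i)) hi
  exact (smul_eq_zero.1 h0).resolve_right (X.ne_zero i)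

theorem toricChart_injective : Function.Injective (toricChart X) := by
  intro x y h
  refine toricAd_ext fun i => ?_
  rw [toricChart, toricChart, ← sub_eq_zero, ← Finset.sum_sub_distrib] at h
  simp_rw [← sub_smul] at h
  exact sub_eq_zero.1 (Fintype.linearIndependent_iff.1 (linearIndependent_cls X) _ h i)

end Chart

section Fibers

/-! ### The center and the class group -/

theorem center_apply_eq_one {z : Torus (weightLattice H)} (hz : z ∈ center H)
    (μ : weightLattice H) (hμ : (μ : Dual ℂ H) ∈ rootLattice H) :
    z (Multiplicative.ofAdd μ) = 1 :=
  DFunLike.congr_fun (show torusProj H z = 1 from hz) (Multiplicative.ofAdd ⟨μ, hμ⟩)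

theorem mem_center_of_apply_eq_one {z : Torus (weightLattice H)}
    (hz : ∀ μ : weightLattice H, (μ : Dual ℂ H) ∈ rootLattice H →
      z (Multiplicative.ofAdd μ) = 1) : z ∈ center H :=
  MonoidHom.ext fun μ => hz ⟨_, rootLattice_le_weightLattice H μ.toAdd.2⟩ μ.toAdd.2

variable (b : (rootSystem H).Base)

theorem center_apply_congr {z : Torus (weightLattice H)} (hz : z ∈ center H)
    {μ ν : weightLattice H} (h : coordMod b μ = coordMod b ν) :
    z (Multiplicative.ofAdd μ) = z (Multiplicative.ofAdd ν) := by
  have h1 : ((μ - ν : weightLattice H) : Dual ℂ H) ∈ rootLattice H := by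
    rw [← coordMod_eq_zero_iff b, AddSubgroup.coe_sub, map_sub, h, sub_self]
  have h2 := center_apply_eq_one hz _ h1
  rwa [ofAdd_sub, map_div, div_eq_one] at h2

variable {b}

/-- An element of the cone semigroup of the weight lattice, as a weight. -/
def toWeight (μ : coneSemigroup b (weightLattice H)) : weightLattice H := ⟨μ, μ.2.1⟩

variable (J : Set b.support)

/-- A representative in the dual cone, orthogonal to the `fundCoweight b j`, `j ∈ J`. -/
def lift (g : classGroup b J) : coneSemigroup b (weightLattice H) :=
  (exists_coneSemigroup_lift b g.2).choose

theorem coordMod_lift (g : classGroup b J) : coordMod b (lift J g) = g :=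
  (exists_coneSemigroup_lift b g.2).choose_spec.1

theorem coord_lift (g : classGroup b J) : ∀ j ∈ J, coord b j (lift J g) = 0 :=
  (exists_coneSemigroup_lift b g.2).choose_spec.2

/-- The restriction of the elements of `Z`, which are the characters of `classGroup b ∅`, to
`classGroup b J`. -/
def centerRestrict : center H →* (Multiplicative (classGroup b J) →* ℂˣ) where
  toFun z := MonoidHom.mk' (fun g => (z : Torus (weightLattice H))
      (Multiplicative.ofAdd (toWeight (lift J g.toAdd)))) fun g h => by
    rw [← map_mul, ← ofAdd_add]
    refine center_apply_congr b z.2 ?_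
    rw [AddSubgroup.coe_add, map_add]
    simp only [toWeight, coordMod_lift, toAdd_mul, AddSubgroup.coe_add]
  map_one' := rfl
  map_mul' _ _ := rfl

theorem centerRestrict_apply (z : center H) (g : classGroup b J) :
    centerRestrict J z (Multiplicative.ofAdd g) =
      (z : Torus (weightLattice H)) (Multiplicative.ofAdd (toWeight (lift J g))) := rfl

theorem apply_eq_centerRestrict (z : center H) (μ : weightLattice H) (g : classGroup b J)
    (h : coordMod b μ = g) :
    (z : Torus (weightLattice H)) (Multiplicative.ofAdd μ) =
      centerRestrict J z (Multiplicative.ofAdd g) := by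
  rw [centerRestrict_apply]
  refine center_apply_congr b z.2 ?_
  rw [h, toWeight, coordMod_lift]

/-- A character of `classGroup b J` is extended to all of `(ℂ/ℤ)ⁿ` and pulled back along `coordMod`.
The result lies in the center because `coordMod` kills the root lattice. -/
theorem centerRestrict_surjective : Function.Surjective (centerRestrict (H := H) J) := by
  intro ψ
  obtain ⟨h, hh⟩ := exists_monoidHom_extension (classGroup b J).subtype
    Subtype.coe_injective (show classGroup b J →+ AddUnits from MonoidHom.toAdditiveRight ψ)
  let z : Torus (weightLattice H) :=
    AddMonoidHom.toMultiplicativeLeft (show weightLattice H →+ Additive ℂˣ from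
      (h.comp (coordMod b)).comp (weightLattice H).subtype)
  have hz : z ∈ center H := by
    refine mem_center_of_apply_eq_one fun μ hμ => ?_
    change h (coordMod b μ) = 0
    rw [(coordMod_eq_zero_iff b _).2 hμ, map_zero]
  refine ⟨⟨z, hz⟩, MonoidHom.ext fun g => ?_⟩
  change h (coordMod b (lift J g.toAdd)) = _
  rw [coordMod_lift]
  exact DFunLike.congr_fun hh g.toAdd

theorem centerRestrict_empty_injective :
    Function.Injective (centerRestrict (H := H) (b := b) ∅) := by
  rw [injective_iff_map_eq_one]
  intro z hz
  refine Subtype.ext (MonoidHom.ext fun μ => ?_)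
  have h := (mem_weightLattice_iff_coordMod b _).1 μ.toAdd.2
  have := apply_eq_centerRestrict ∅ z μ.toAdd ⟨_, h, fun j hj => hj.elim⟩ rfl
  rw [hz] at this
  exact this

/-! ### The fibers of the quotient map -/

theorem orbit_eval_ne_zero_iff {y : ToricAd b}
    (hy : y ∈ MulAction.orbit (Torus (rootLattice H)) (distinguishedPoint b J))
    (μ : coneSemigroup b (rootLattice H)) : y.eval μ ≠ 0 ↔ ∀ j ∈ J, coord b j μ = 0 := by
  classical
  obtain ⟨t, rfl⟩ := hy
  change charVal b t μ * (if _ then 1 else 0) ≠ 0 ↔ _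
  simp_rw [apply_fundCoweight]
  have h : charVal b t μ ≠ 0 := Units.ne_zero _
  split_ifs with h'
  · rw [mul_one]
    exact iff_of_true h h'
  · rw [mul_zero]
    exact iff_of_false (fun h => h rfl) h'

variable {J}

/-- Vanishing is unchanged by taking `N`-th powers, and `N • μ` lies in the root lattice, where the
support of `toricQuot b w` is known. -/
theorem eval_ne_zero_iff {w : W b}
    (hw : toricQuot b w ∈ MulAction.orbit (Torus (rootLattice H)) (distinguishedPoint b J))
    (μ : coneSemigroup b (weightLattice H)) : w.eval μ ≠ 0 ↔ ∀ j ∈ J, coord b j μ = 0 := by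
  obtain ⟨N, hN, h⟩ := exists_nsmul_mem_rootLattice b
  let q : coneSemigroup b (rootLattice H) := ⟨N • μ, h _ μ.2.1, (N • μ).2.2⟩
  have hq : semigroupIncl b q = N • μ := Subtype.ext rfl
  have h1 : (toricQuot b w).eval q = w.eval μ ^ N := by
    rw [← ToricVariety.eval_nsmul, ← hq]
    rfl
  have h2 := orbit_eval_ne_zero_iff J hw q
  rw [h1, ne_eq, pow_eq_zero_iff hN] at h2
  rw [ne_eq, h2]
  refine forall₂_congr fun j _ => ?_
  change coord b j (N • (μ : Dual ℂ H)) = 0 ↔ _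
  rw [map_nsmul, smul_eq_zero]
  simp [hN]

theorem smul_eval (z : Torus (weightLattice H)) (w : W b) (μ : coneSemigroup b (weightLattice H)) :
    (z • w).eval μ = (z (Multiplicative.ofAdd (toWeight μ)) : ℂˣ) * w.eval μ := rfl

theorem toricQuot_smul (z : center H) (w : W b) : toricQuot b (z • w) = toricQuot b w := by
  refine ToricVariety.ext (funext fun μ => ?_)
  change (z.1 • w).eval _ = w.eval _
  rw [smul_eval, center_apply_eq_one z.2 _ μ.2.1, Units.val_one, one_mul]

theorem coordMod_mem_classGroup (μ : coneSemigroup b (weightLattice H))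
    (hμ : ∀ j ∈ J, coord b j μ = 0) : coordMod b μ ∈ classGroup b J :=
  ⟨(mem_weightLattice_iff_coordMod b _).1 μ.2.1, fun j hj => by
    rw [coordMod_apply, hμ j hj, map_zero]⟩

/-- Fixing `w` means being trivial on the weights where `w` is nonzero, and the classes of these
weights fill out `classGroup b J`. -/
theorem stabilizer_eq_ker {w : W b}
    (hw : toricQuot b w ∈ MulAction.orbit (Torus (rootLattice H)) (distinguishedPoint b J)) :
    MulAction.stabilizer (center H) w = (centerRestrict J).ker := by
  ext z
  rw [MulAction.mem_stabilizer_iff, MonoidHom.mem_ker]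
  constructor
  · intro hz
    refine MonoidHom.ext fun g => ?_
    have h : (z.1 • w).eval (lift J g.toAdd) = w.eval (lift J g.toAdd) :=
      congrArg (fun x : W b => x.eval (lift J g.toAdd)) hz
    rw [smul_eval] at h
    have h0 := (eval_ne_zero_iff hw _).2 (coord_lift J g.toAdd)
    exact Units.ext (mul_right_cancel₀ h0 (h.trans (one_mul _).symm))
  · intro hz
    refine ToricVariety.ext (funext fun μ => ?_)
    change (z.1 • w).eval μ = _
    rw [smul_eval]
    by_cases hμ : ∀ j ∈ J, coord b j μ = 0
    · rw [apply_eq_centerRestrict J z (toWeight μ) ⟨_, coordMod_mem_classGroup μ hμ⟩ rfl, hz,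
        MonoidHom.one_apply, Units.val_one, one_mul]
    · rw [not_not.1 (mt (eval_ne_zero_iff hw μ).1 hμ), mul_zero]

/-- Two weights in the dual cone with the same class differ by elements of the root lattice in the
dual cone. -/
theorem exists_add_eq_add {μ ν : coneSemigroup b (weightLattice H)}
    (hμ : ∀ j ∈ J, coord b j μ = 0) (hν : ∀ j ∈ J, coord b j ν = 0)
    (h : coordMod b μ = coordMod b ν) :
    ∃ p q : coneSemigroup b (rootLattice H), (∀ j ∈ J, coord b j p = 0) ∧
      (∀ j ∈ J, coord b j q = 0) ∧ μ + semigroupIncl b p = ν + semigroupIncl b q := by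
  obtain ⟨N, hN, hQ⟩ := exists_nsmul_mem_rootLattice b
  obtain ⟨M, rfl⟩ := Nat.exists_eq_succ_of_ne_zero hN
  have hd : (μ - ν : Dual ℂ H) ∈ rootLattice H := by
    rw [← coordMod_eq_zero_iff b, map_sub, h, sub_self]
  -- With `N = M + 1`, the identity is `μ + Nν = ν + (Mν + μ)`. Here `Mν + μ = Nν + (μ - ν)` lies in
  -- the root lattice, and no subtraction takes place inside the cone.
  let q : coneSemigroup b (rootLattice H) :=
    ⟨(M.succ • ν : coneSemigroup b (weightLattice H)), hQ _ ν.2.1, (M.succ • ν).2.2⟩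
  have hp : (M • ν + μ : Dual ℂ H) ∈ rootLattice H := by
    have : (M • ν + μ : Dual ℂ H) = M.succ • ν + (μ - ν) := by
      rw [Nat.succ_eq_add_one, add_smul, one_smul]
      abel
    rw [this]
    exact add_mem (hQ _ ν.2.1) hd
  let p : coneSemigroup b (rootLattice H) :=
    ⟨(M • ν + μ : coneSemigroup b (weightLattice H)), hp, (M • ν + μ).2.2⟩
  refine ⟨q, p, fun j hj => ?_, fun j hj => ?_, Subtype.ext ?_⟩
  · change coord b j (M.succ • (ν : Dual ℂ H)) = 0
    rw [map_nsmul, hν j hj, smul_zero]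
  · change coord b j (M • (ν : Dual ℂ H) + μ) = 0
    rw [map_add, map_nsmul, hν j hj, hμ j hj, smul_zero, add_zero]
  · change (μ + M.succ • ν : Dual ℂ H) = ν + (M • ν + μ)
    rw [Nat.succ_eq_add_one, add_smul, one_smul]
    abel

/-- On their common support, the ratio of `w'` to `w` depends only on the class of the weight: two
weights of the same class agree after adding root lattice elements, where `w` and `w'` coincide. The
ratio is thus a character of `classGroup b J`, induced by some element of the center. -/
theorem exists_smul_eq {w w' : W b}
    (hw : toricQuot b w ∈ MulAction.orbit (Torus (rootLattice H)) (distinguishedPoint b J))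
    (h : toricQuot b w' = toricQuot b w) : ∃ z : center H, z • w = w' := by
  have hw' : toricQuot b w' ∈
    MulAction.orbit (Torus (rootLattice H)) (distinguishedPoint b J) := h ▸ hw
  have hQ : ∀ p, w'.eval (semigroupIncl b p) = w.eval (semigroupIncl b p) :=
    fun p => congrArg (fun x : ToricAd b => x.eval p) h
  have hcongr : ∀ μ ν : coneSemigroup b (weightLattice H), (∀ j ∈ J, coord b j μ = 0) →
      (∀ j ∈ J, coord b j ν = 0) → coordMod b μ = coordMod b ν →
      w'.eval μ / w.eval μ = w'.eval ν / w.eval ν := by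
    intro μ ν hμ hν hμν
    obtain ⟨p, q, hp, hq, hpq⟩ := exists_add_eq_add hμ hν hμν
    have h1 : w.eval μ * w.eval (semigroupIncl b p) = w.eval ν * w.eval (semigroupIncl b q) := by
      rw [← w.eval_add, ← w.eval_add, hpq]
    have h2 : w'.eval μ * w.eval (semigroupIncl b p) = w'.eval ν * w.eval (semigroupIncl b q) := by
      rw [← hQ, ← hQ, ← w'.eval_add, ← w'.eval_add, hpq]
    have hp0 : w.eval (semigroupIncl b p) ≠ 0 := (eval_ne_zero_iff hw _).2 hp
    have hq0 : w.eval (semigroupIncl b q) ≠ 0 := (eval_ne_zero_iff hw _).2 hq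
    rw [← mul_div_mul_right _ _ hp0, h1, h2, mul_div_mul_right _ _ hq0]
  have hmul : ∀ g k : classGroup b J, w'.eval (lift J (g + k)) / w.eval (lift J (g + k)) =
      w'.eval (lift J g) / w.eval (lift J g) * (w'.eval (lift J k) / w.eval (lift J k)) := by
    intro g k
    rw [div_mul_div_comm, ← w'.eval_add, ← w.eval_add]
    refine hcongr _ _ (coord_lift J _) (fun j hj => ?_) ?_
    · rw [AddSubmonoid.coe_add, map_add, coord_lift J _ j hj, coord_lift J _ j hj, add_zero]
    · rw [AddSubmonoid.coe_add, map_add, coordMod_lift, coordMod_lift, coordMod_lift,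
        AddSubgroup.coe_add]
  have hne : ∀ g : classGroup b J, w'.eval (lift J g) / w.eval (lift J g) ≠ 0 := fun g =>
    div_ne_zero ((eval_ne_zero_iff hw' _).2 (coord_lift J _))
      ((eval_ne_zero_iff hw _).2 (coord_lift J _))
  let ψ : Multiplicative (classGroup b J) →* ℂˣ :=
    MonoidHom.mk' (fun g => Units.mk0 _ (hne g.toAdd)) fun g k =>
      Units.ext (hmul g.toAdd k.toAdd)
  obtain ⟨z, hz⟩ := centerRestrict_surjective J ψ
  refine ⟨z, ToricVariety.ext (funext fun μ => ?_)⟩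
  change (z.1 • w).eval μ = _
  rw [smul_eval]
  by_cases hμ : ∀ j ∈ J, coord b j μ = 0
  · rw [apply_eq_centerRestrict J z (toWeight μ) ⟨_, coordMod_mem_classGroup μ hμ⟩ rfl, hz]
    change w'.eval (lift J _) / w.eval (lift J _) * w.eval μ = _
    rw [hcongr _ μ (coord_lift J _) hμ (coordMod_lift J _),
      div_mul_cancel₀ _ ((eval_ne_zero_iff hw μ).2 hμ)]
  · rw [not_not.1 (mt (eval_ne_zero_iff hw μ).1 hμ), mul_zero,
      not_not.1 (mt (eval_ne_zero_iff hw' μ).1 hμ)]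

open Classical in
theorem exists_toricQuot_eq {y : ToricAd b}
    (hy : y ∈ MulAction.orbit (Torus (rootLattice H)) (distinguishedPoint b J)) :
    ∃ w : W b, toricQuot b w = y := by
  have hne : ∀ i, i ∉ J → y.eval ⟨_, root_mem_coneSemigroup b i⟩ ≠ 0 := by
    intro i hi
    rw [orbit_eval_ne_zero_iff J hy]
    intro j hj
    exact (coord_simpleRoot b j i).trans (if_neg fun h : j = i => hi (h ▸ hj))
  have hzero : ∀ i, i ∈ J → y.eval ⟨_, root_mem_coneSemigroup b i⟩ = 0 := by
    intro i hi
    rw [← not_ne_iff, orbit_eval_ne_zero_iff J hy]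
    intro h
    exact one_ne_zero (((coord_simpleRoot b i i).trans (if_pos rfl)).symm.trans (h i hi))
  -- A choice of logarithms defines the fractional powers of the coordinates. For `i ∈ J` the
  -- argument is `0`, but this value is only ever multiplied by a vanishing coordinate.
  let a : b.support → ℂ := fun i => Complex.log (y.eval ⟨_, root_mem_coneSemigroup b i⟩)
  have key : ∀ μ ν : coneSemigroup b (weightLattice H),
      (∀ j ∈ J, coord b j ((μ + ν : coneSemigroup b (weightLattice H)) : Dual ℂ H) = 0) ↔
        (∀ j ∈ J, coord b j μ = 0) ∧ ∀ j ∈ J, coord b j ν = 0 := by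
    intro μ ν
    rw [← forall₂_and]
    refine forall₂_congr fun j _ => ?_
    obtain ⟨r, hr, h⟩ := ((mem_coneSemigroup_iff b _ _).1 μ.2).2 j
    obtain ⟨s, hs, h'⟩ := ((mem_coneSemigroup_iff b _ _).1 ν.2).2 j
    rw [AddSubmonoid.coe_add, map_add, h, h']
    norm_cast
    exact add_eq_zero_iff_of_nonneg hr hs
  let w : W b :=
    { eval := fun μ => if ∀ j ∈ J, coord b j μ = 0 then Complex.exp (∑ i, coord b i μ * a i) else 0
      eval_zero := by
        rw [if_pos fun j _ => by rw [AddSubmonoid.coe_zero, map_zero]]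
        simp
      eval_add := fun μ ν => by
        rw [if_congr (key μ ν) rfl rfl, ite_and, ite_mul, zero_mul, mul_ite, mul_zero,
          ← Complex.exp_add, ← Finset.sum_add_distrib]
        simp_rw [AddSubmonoid.coe_add, map_add, add_mul] }
  refine ⟨w, toricAd_ext fun i => ?_⟩
  change (if ∀ j ∈ J, coord b j (simpleRoot b i) = 0 then
    Complex.exp (∑ k, coord b k (simpleRoot b i) * a k) else 0) = _
  simp_rw [coord_simpleRoot]
  by_cases hi : i ∈ J
  · rw [hzero i hi, if_neg]
    intro h
    simpa using h i hi
  · rw [if_pos fun j hj => if_neg fun h : j = i => hi (h ▸ hj)]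
    simp only [ite_mul, one_mul, zero_mul, Finset.sum_ite_eq', Finset.mem_univ, if_true]
    exact Complex.exp_log (hne i hi)

theorem fiberGroupIs_of_mulEquiv (X : SimpleRootVectors b) {A : Type*} [Group A]
    (h : Nonempty ((Multiplicative (classGroup b J) →* ℂˣ) ≃* A)) : FiberGroupIs X J A := by
  rintro _ ⟨y, hy, rfl⟩
  have hfiber : ∀ w : W b, w ∈ rho X ⁻¹' {toricChart X y} ↔ toricQuot b w = y :=
    fun w => (toricChart_injective X).eq_iff
  refine ⟨?_, fun w hw => ⟨?_, ?_⟩⟩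
  · obtain ⟨w, hw⟩ := exists_toricQuot_eq hy
    exact ⟨w, (hfiber w).2 hw⟩
  · rw [hfiber] at hw
    subst hw
    ext w'
    rw [hfiber]
    constructor
    · exact fun h => exists_smul_eq hy h
    · rintro ⟨z, rfl⟩
      exact toricQuot_smul z w
  · rw [hfiber] at hw
    subst hw
    obtain ⟨e⟩ := h
    exact ⟨((QuotientGroup.quotientMulEquivOfEq (stabilizer_eq_ker hy)).trans
      (QuotientGroup.quotientKerEquivOfSurjective _ (centerRestrict_surjective J))).trans e⟩

end Fibers

/-! ### Recognizing the fiber groups -/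

section Recognition

variable {b : (rootSystem H).Base} {J : Set b.support} (X : SimpleRootVectors b)

theorem fiberGroupIs_unit (h : ∀ u ∈ classGroup b J, u = 0) : FiberGroupIs X J Unit := by
  have : Subsingleton (Multiplicative (classGroup b J) →* ℂˣ) := by
    refine ⟨fun φ ψ => MonoidHom.ext fun g => ?_⟩
    have hg : g = 1 := Multiplicative.toAdd.injective (Subtype.ext (h _ g.toAdd.2))
    rw [hg, map_one, map_one]
  exact fiberGroupIs_of_mulEquiv X
    ⟨⟨⟨fun _ => (), fun _ => 1, fun _ => Subsingleton.elim _ _, fun _ => rfl⟩, fun _ _ => rfl⟩⟩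

/-- If `J` imposes no condition, the fiber group is the full character group of `classGroup b ∅`,
which is the center itself. -/
theorem fiberGroupIs_center (h : classGroup b ∅ ≤ classGroup b J) :
    FiberGroupIs X J (center H) := by
  have hJ : classGroup b J = classGroup b ∅ :=
    le_antisymm (fun u hu => ⟨hu.1, fun j hj => hj.elim⟩) h
  let e : center H ≃* (Multiplicative (classGroup b ∅) →* ℂˣ) :=
    MulEquiv.ofBijective (centerRestrict (H := H) (b := b) ∅)
      ⟨centerRestrict_empty_injective, centerRestrict_surjective ∅⟩
  have h' : Nonempty ((Multiplicative (classGroup b ∅) →* ℂˣ) ≃* center H) := ⟨e.symm⟩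
  rw [← hJ] at h'
  exact fiberGroupIs_of_mulEquiv X h'

/-- The `i`-th coordinate maps the class group isomorphically onto the `c`-th roots of unity, and a
finite abelian group is isomorphic to its character group over `ℂ`. -/
theorem fiberGroupIs_zmod (c : ℕ) [NeZero c] (i : b.support)
    (hinj : ∀ u ∈ classGroup b J, u i = 0 → u = 0)
    (htors : ∀ u ∈ classGroup b J, c • u i = 0)
    (hsurj : ∀ t : AddUnits, c • t = 0 → ∃ u ∈ classGroup b J, u i = t) :
    FiberGroupIs X J (Multiplicative (ZMod c)) := by
  let φ : Multiplicative (classGroup b J) →* ℂˣ :=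
    AddMonoidHom.toMultiplicativeLeft (show classGroup b J →+ Additive ℂˣ from
      (Pi.evalAddMonoidHom (fun _ : b.support => AddUnits) i).comp (classGroup b J).subtype)
  have hφi : Function.Injective φ := by
    rw [injective_iff_map_eq_one]
    exact fun g hg => Multiplicative.toAdd.injective (Subtype.ext (hinj _ g.toAdd.2 hg))
  have hrange : φ.range = rootsOfUnity c ℂ := by
    ext t
    rw [mem_rootsOfUnity]
    constructor
    · rintro ⟨g, rfl⟩
      exact htors _ g.toAdd.2
    · intro ht
      obtain ⟨u, hu, h⟩ := hsurj (Additive.ofMul t) ht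
      exact ⟨Multiplicative.ofAdd ⟨u, hu⟩, h⟩
  have e1 : Multiplicative (classGroup b J) ≃* rootsOfUnity c ℂ :=
    (MonoidHom.ofInjective hφi).trans (MulEquiv.subgroupCongr hrange)
  have hcard : Nat.card (rootsOfUnity c ℂ) = c := by
    exact Complex.card_rootsOfUnity c
  have e2 : Multiplicative (classGroup b J) ≃* Multiplicative (ZMod c) :=
    e1.trans (mulEquivOfCyclicCardEq (by
      rw [hcard, Nat.card_congr Multiplicative.toAdd, Nat.card_zmod]))
  have : Finite (Multiplicative (classGroup b J)) := Finite.of_equiv _ e1.symm.toEquiv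
  obtain ⟨e3⟩ := CommGroup.monoidHom_mulEquiv_of_hasEnoughRootsOfUnity
    (Multiplicative (classGroup b J)) ℂ
  exact fiberGroupIs_of_mulEquiv X ⟨e3.trans e2⟩

end Recognition

/-! ### Solutions indexed by natural numbers -/

section Indexing

/-- The sequence `f 1, …, f n` is killed by all columns of the matrix `C`. -/
def IsColumnSolution {n : ℕ} (C : Matrix (Fin n) (Fin n) ℤ) (f : ℕ → AddUnits) : Prop :=
  ∀ j, ∑ i, C i j • f (i + 1) = 0

theorem sum_ite_smul (n k : ℕ) (a : ℤ) (f : ℕ → AddUnits) :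
    ∑ i : Fin n, (if (i : ℕ) + 1 = k then a else 0) • f (i + 1) =
      if 1 ≤ k ∧ k ≤ n then a • f k else 0 := by
  split_ifs with h
  · rw [Finset.sum_eq_single ⟨k - 1, by omega⟩]
    · rw [if_pos (by simp; omega)]
      congr 2
      simp
      omega
    · intro i _ hi
      rw [if_neg, zero_smul]
      intro h'
      exact hi (Fin.ext (by simp; omega))
    · simp
  · refine Finset.sum_eq_zero fun i _ => ?_
    rw [if_neg, zero_smul]
    omega

variable {b : (rootSystem H).Base} {n : ℕ} {C : Matrix (Fin n) (Fin n) ℤ} {e : Fin n ≃ b.support}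

theorem mem_classGroup_iff (he : HasCartanMatrix b C e) {J : Finset ℕ} (hJ : J ⊆ Finset.Icc 1 n)
    (f : ℕ → AddUnits) :
    (fun s => f (e.symm s + 1)) ∈ classGroup b (simpleRootsOf b e J) ↔
      IsColumnSolution C f ∧ ∀ j ∈ J, f j = 0 := by
  refine and_congr ?_ ?_
  · rw [← e.forall_congr_right]
    refine forall_congr' fun j => ?_
    rw [← e.sum_comp]
    simp_rw [he _ j, Equiv.symm_apply_apply]
  · constructor
    · intro h j hj
      have hj' := Finset.mem_Icc.1 (hJ hj)
      have hs : ((⟨j - 1, by omega⟩ : Fin n) : ℕ) + 1 = j := by simp; omega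
      have := h (e ⟨j - 1, by omega⟩) (by
        change (e.symm (e _) : ℕ) + 1 ∈ J
        rwa [Equiv.symm_apply_apply, hs])
      dsimp only at this
      rwa [Equiv.symm_apply_apply, hs] at this
    · exact fun h j hj => h _ hj

/-- The sequence vanishing outside `{1, …, n}` with the same entries as `u`. -/
def toSeq (e : Fin n ≃ b.support) (u : b.support → AddUnits) (k : ℕ) : AddUnits :=
  if h : 1 ≤ k ∧ k ≤ n then u (e ⟨k - 1, by omega⟩) else 0

theorem toSeq_symm (e : Fin n ≃ b.support) (u : b.support → AddUnits) :
    (fun s => toSeq e u (e.symm s + 1)) = u := by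
  funext s
  have := (e.symm s).2
  rw [toSeq, dif_pos (by omega)]
  simp

theorem toSeq_zero (e : Fin n ≃ b.support) (u : b.support → AddUnits) : toSeq e u 0 = 0 :=
  dif_neg (by omega)

theorem toSeq_of_lt (e : Fin n ≃ b.support) (u : b.support → AddUnits) {k : ℕ} (hk : n < k) :
    toSeq e u k = 0 :=
  dif_neg (by omega)

/-- A solution for the matrix `C`, vanishing on `J` and outside `{1, …, n}`. -/
structure IsSolution (C : Matrix (Fin n) (Fin n) ℤ) (J : Finset ℕ) (f : ℕ → AddUnits) : Prop where
  col : IsColumnSolution C f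
  vanish : ∀ j ∈ J, f j = 0
  zero : f 0 = 0
  of_lt : ∀ k, n < k → f k = 0

theorem isSolution_toSeq (he : HasCartanMatrix b C e) {J : Finset ℕ} (hJ : J ⊆ Finset.Icc 1 n)
    {u : b.support → AddUnits} (hu : u ∈ classGroup b (simpleRootsOf b e J)) :
    IsSolution C J (toSeq e u) := by
  rw [← toSeq_symm e u, mem_classGroup_iff he hJ] at hu
  exact ⟨hu.1, hu.2, toSeq_zero e u, fun k => toSeq_of_lt e u⟩

theorem fiberGroupIs_unit_of_isSolution (X : SimpleRootVectors b) (he : HasCartanMatrix b C e)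
    {J : Finset ℕ} (hJ : J ⊆ Finset.Icc 1 n) (h : ∀ f, IsSolution C J f → ∀ k, f k = 0) :
    FiberGroupIs X (simpleRootsOf b e J) Unit := by
  refine fiberGroupIs_unit X fun u hu => ?_
  rw [← toSeq_symm e u]
  exact funext fun s => h _ (isSolution_toSeq he hJ hu) _

theorem fiberGroupIs_center_of_isSolution (X : SimpleRootVectors b) (he : HasCartanMatrix b C e)
    {J : Finset ℕ} (hJ : J ⊆ Finset.Icc 1 n)
    (h : ∀ f, IsSolution C ∅ f → ∀ j ∈ J, f j = 0) :
    FiberGroupIs X (simpleRootsOf b e J) (center H) := by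
  refine fiberGroupIs_center X fun u hu => ?_
  have hu' : u ∈ classGroup b (simpleRootsOf b e ∅) :=
    ⟨hu.1, fun j hj => (Finset.notMem_empty _ hj).elim⟩
  have hf := isSolution_toSeq he (Finset.empty_subset _) hu'
  rw [← toSeq_symm e u, mem_classGroup_iff he hJ]
  exact ⟨hf.col, h _ hf⟩

theorem fiberGroupIs_zmod_of_isSolution (X : SimpleRootVectors b) (he : HasCartanMatrix b C e)
    {J : Finset ℕ} (hJ : J ⊆ Finset.Icc 1 n) (c : ℕ) [NeZero c] {i : ℕ} (hi : i ∈ Finset.Icc 1 n)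
    (hinj : ∀ f, IsSolution C J f → f i = 0 → ∀ k, f k = 0)
    (htors : ∀ f, IsSolution C J f → c • f i = 0)
    -- The witness need not vanish outside `{1, …, n}`, so formulas such as `k • t` are allowed.
    (hsurj : ∀ t : AddUnits, c • t = 0 →
      ∃ f, IsColumnSolution C f ∧ (∀ j ∈ J, f j = 0) ∧ f i = t) :
    FiberGroupIs X (simpleRootsOf b e J) (Multiplicative (ZMod c)) := by
  rw [Finset.mem_Icc] at hi
  have hval : ∀ u : b.support → AddUnits, toSeq e u i = u (e ⟨i - 1, by omega⟩) :=
    fun u => dif_pos hi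
  refine fiberGroupIs_zmod X c (e ⟨i - 1, by omega⟩) (fun u hu h => ?_) (fun u hu => ?_)
    (fun t ht => ?_)
  · rw [← toSeq_symm e u]
    rw [← hval u] at h
    exact funext fun s => hinj _ (isSolution_toSeq he hJ hu) h _
  · rw [← hval u]
    exact htors _ (isSolution_toSeq he hJ hu)
  · obtain ⟨f, hf, hfJ, rfl⟩ := hsurj t ht
    refine ⟨_, (mem_classGroup_iff he hJ f).2 ⟨hf, hfJ⟩, ?_⟩
    rw [Equiv.symm_apply_apply]
    congr 1
    simp
    omega

end Indexing

/-! ### The column equations of the Cartan matrices -/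

section Columns

variable {n : ℕ} {f : ℕ → AddUnits}

/-- Column `j`, counted from `0`, belongs to node `j + 1`, with neighbors `j` and `j + 2`. The
convention `f 0 = 0` absorbs the missing left neighbor of the first node; the right one is cut off
explicitly. -/
theorem sum_tridiagonal_smul (h0 : f 0 = 0) {j : ℕ} (hj : j < n) (p q : ℤ) :
    ∑ i : Fin n, ((if (i : ℕ) + 1 = j + 1 then 2 else 0) + (if (i : ℕ) + 1 = j then p else 0) +
        (if (i : ℕ) + 1 = j + 2 then q else 0)) • f (i + 1) =
      (2 : ℤ) • f (j + 1) + p • f j + q • (if j + 2 ≤ n then f (j + 2) else 0) := by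
  simp_rw [add_smul, Finset.sum_add_distrib, sum_ite_smul]
  congr 1
  · congr 1
    · rw [if_pos (by omega)]
    · rcases Nat.eq_zero_or_pos j with rfl | h
      · simp [h0]
      · rw [if_pos (by omega)]
  · by_cases h : j + 2 ≤ n
    · rw [if_pos (by omega), if_pos h]
    · rw [if_neg (by omega), if_neg h, smul_zero]

theorem isColumnSolution_A (h0 : f 0 = 0) : IsColumnSolution (CartanMatrix.A n) f ↔
    ∀ j < n, (2 : ℤ) • f (j + 1) + (-1 : ℤ) • f j +
      (-1 : ℤ) • (if j + 2 ≤ n then f (j + 2) else 0) = 0 := by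
  rw [IsColumnSolution, Fin.forall_iff]
  refine forall₂_congr fun j hj => ?_
  rw [← sum_tridiagonal_smul h0 hj]
  refine Eq.congr_left (Finset.sum_congr rfl fun i _ => ?_)
  congr 1
  simp only [CartanMatrix.A, Matrix.of_apply, Fin.ext_iff]
  split_ifs <;> omega

theorem isColumnSolution_B (h0 : f 0 = 0) : IsColumnSolution (CartanMatrix.B n) f ↔
    ∀ j < n, (2 : ℤ) • f (j + 1) + (if j = n - 1 then -2 else -1 : ℤ) • f j +
      (-1 : ℤ) • (if j + 2 ≤ n then f (j + 2) else 0) = 0 := by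
  rw [IsColumnSolution, Fin.forall_iff]
  refine forall₂_congr fun j hj => ?_
  rw [← sum_tridiagonal_smul h0 hj]
  refine Eq.congr_left (Finset.sum_congr rfl fun i _ => ?_)
  congr 1
  simp only [CartanMatrix.B, Matrix.of_apply, Fin.ext_iff]
  split_ifs <;> omega

theorem isColumnSolution_C (h0 : f 0 = 0) : IsColumnSolution (CartanMatrix.C n) f ↔
    ∀ j < n, (2 : ℤ) • f (j + 1) + (-1 : ℤ) • f j +
      (if j + 2 = n then -2 else -1 : ℤ) • (if j + 2 ≤ n then f (j + 2) else 0) = 0 := by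
  rw [IsColumnSolution, Fin.forall_iff]
  refine forall₂_congr fun j hj => ?_
  rw [← sum_tridiagonal_smul h0 hj]
  refine Eq.congr_left (Finset.sum_congr rfl fun i _ => ?_)
  congr 1
  simp only [CartanMatrix.C, Matrix.of_apply, Fin.ext_iff]
  split_ifs <;> omega

theorem isColumnSolution_D (h0 : f 0 = 0) (hn : 3 ≤ n) : IsColumnSolution (CartanMatrix.D n) f ↔
    (∀ j, j + 3 < n → (2 : ℤ) • f (j + 1) + (-1 : ℤ) • f j + (-1 : ℤ) • f (j + 2) = 0) ∧
    (2 : ℤ) • f (n - 2) + (-1 : ℤ) • f (n - 3) + (-1 : ℤ) • f (n - 1) + (-1 : ℤ) • f n = 0 ∧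
    (2 : ℤ) • f (n - 1) + (-1 : ℤ) • f (n - 2) = 0 ∧
    (2 : ℤ) • f n + (-1 : ℤ) • f (n - 2) = 0 := by
  obtain ⟨m, rfl⟩ := Nat.exists_eq_add_of_le' hn
  simp only [show m + 3 - 2 = m + 1 by omega, show m + 3 - 3 = m by omega,
    show m + 3 - 1 = m + 2 by omega]
  have hstd : ∀ j (hj : j < m), ∑ i, CartanMatrix.D (m + 3) i ⟨j, by omega⟩ • f (i + 1) =
      (2 : ℤ) • f (j + 1) + (-1 : ℤ) • f j + (-1 : ℤ) • f (j + 2) := by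
    intro j hj
    have := sum_tridiagonal_smul h0 (show j < m + 3 by omega) (-1) (-1)
    rw [if_pos (by omega)] at this
    rw [← this]
    refine Finset.sum_congr rfl fun i _ => ?_
    congr 1
    simp only [CartanMatrix.D, Matrix.of_apply, Fin.ext_iff]
    split_ifs <;> omega
  have hbranch : ∑ i, CartanMatrix.D (m + 3) i ⟨m, by omega⟩ • f (i + 1) =
      (2 : ℤ) • f (m + 1) + (-1 : ℤ) • f m + (-1 : ℤ) • f (m + 2) + (-1 : ℤ) • f (m + 3) := by
    have := sum_tridiagonal_smul h0 (show m < m + 3 by omega) (-1) (-1)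
    rw [if_pos (by omega)] at this
    have h2 := sum_ite_smul (m + 3) (m + 3) (-1) f
    rw [if_pos (by omega)] at h2
    rw [← this, ← h2, ← Finset.sum_add_distrib]
    refine Finset.sum_congr rfl fun i _ => ?_
    rw [← add_smul]
    congr 1
    simp only [CartanMatrix.D, Matrix.of_apply, Fin.ext_iff, true_and]
    split_ifs <;> omega
  have hpenult : ∑ i, CartanMatrix.D (m + 3) i ⟨m + 1, by omega⟩ • f (i + 1) =
      (2 : ℤ) • f (m + 2) + (-1 : ℤ) • f (m + 1) := by
    have h1 := sum_ite_smul (m + 3) (m + 2) 2 f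
    have h2 := sum_ite_smul (m + 3) (m + 1) (-1) f
    rw [if_pos (by omega)] at h1 h2
    rw [← h1, ← h2, ← Finset.sum_add_distrib]
    refine Finset.sum_congr rfl fun i _ => ?_
    rw [← add_smul]
    congr 1
    simp only [CartanMatrix.D, Matrix.of_apply, Fin.ext_iff, true_or, and_true]
    split_ifs <;> omega
  have hlast : ∑ i, CartanMatrix.D (m + 3) i ⟨m + 2, by omega⟩ • f (i + 1) =
      (2 : ℤ) • f (m + 3) + (-1 : ℤ) • f (m + 1) := by
    have h1 := sum_ite_smul (m + 3) (m + 3) 2 f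
    have h2 := sum_ite_smul (m + 3) (m + 1) (-1) f
    rw [if_pos (by omega)] at h1 h2
    rw [← h1, ← h2, ← Finset.sum_add_distrib]
    refine Finset.sum_congr rfl fun i _ => ?_
    rw [← add_smul]
    congr 1
    simp only [CartanMatrix.D, Matrix.of_apply, Fin.ext_iff, or_true, and_true]
    split_ifs <;> omega
  rw [← hbranch, ← hpenult, ← hlast]
  constructor
  · exact fun h => ⟨fun j hj => (hstd j (by omega)).symm.trans (h _), h _, h _, h _⟩
  · rintro ⟨h1, h2, h3, h4⟩ ⟨j, hj⟩
    rcases lt_or_ge j m with h | h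
    · exact (hstd j h).trans (h1 j (by omega))
    · obtain rfl | rfl | rfl : j = m ∨ j = m + 1 ∨ j = m + 2 := by omega
      · exact h2
      · exact h3
      · exact h4

end Columns

/-! ### Torsion and linear recurrences in abelian groups. -/

section Torsion

variable {M : Type*} [AddCommGroup M]

theorem gcd_nsmul_eq_zero_iff (s : Finset ℕ) (t : M) :
    s.gcd id • t = 0 ↔ ∀ j ∈ s, j • t = 0 := by
  simp_rw [← addOrderOf_dvd_iff_nsmul_eq_zero, Finset.dvd_gcd_iff, id]

theorem even_nsmul_eq_zero {t : M} (ht : 2 • t = 0) {k : ℕ} (hk : Even k) : k • t = 0 := by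
  obtain ⟨m, rfl⟩ := hk
  rw [← two_mul, mul_comm, mul_nsmul', ht, nsmul_zero]

theorem odd_nsmul_eq_self {t : M} (ht : 2 • t = 0) {k : ℕ} (hk : ¬ Even k) : k • t = t := by
  obtain ⟨m, rfl⟩ := Nat.not_even_iff_odd.1 hk
  rw [add_smul, one_smul, even_nsmul_eq_zero ht (even_two_mul m), zero_add]

theorem eq_nsmul_of_recurrence {f : ℕ → M} (h0 : f 0 = 0) {m : ℕ}
    (h : ∀ j, j + 2 ≤ m → (2 : ℤ) • f (j + 1) + (-1 : ℤ) • f j + (-1 : ℤ) • f (j + 2) = 0) :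
    ∀ k ≤ m, f k = k • f 1
  | 0, _ => by rw [h0, zero_smul]
  | 1, _ => by rw [one_smul]
  | k + 2, hk => by
    have h1 := eq_nsmul_of_recurrence h0 h k (by omega)
    have h2 := eq_nsmul_of_recurrence h0 h (k + 1) (by omega)
    have h3 := h k hk
    rw [h1, h2] at h3
    have : f (k + 2) = (2 : ℤ) • (k + 1) • f 1 + (-1 : ℤ) • k • f 1 := by
      rw [← sub_eq_zero, ← neg_eq_zero, ← h3]
      module
    rw [this]
    module

end Torsion

/-! ### The fiber groups in the different types -/

section Types

variable {b : (rootSystem H).Base} (X : SimpleRootVectors b) {n : ℕ} {e : Fin n ≃ b.support}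
  {J : Finset ℕ}

theorem IsSolution.eq_nsmul_A {f : ℕ → AddUnits} (hf : IsSolution (CartanMatrix.A n) J f) :
    ∀ k ≤ n + 1, f k = k • f 1 := by
  refine eq_nsmul_of_recurrence hf.zero fun j hj => ?_
  have h := (isColumnSolution_A hf.zero).1 hf.col j (by omega)
  split_ifs at h with h'
  · exact h
  · rwa [hf.of_lt (j + 2) (by omega)]

theorem fiberGroupIs_A (he : HasCartanMatrix b (CartanMatrix.A n) e) (hJ : J ⊆ Finset.Icc 1 n)
    (hne : J.Nonempty) :
    FiberGroupIs X (simpleRootsOf b e J) (Multiplicative (ZMod ((insert (n + 1) J).gcd id))) := by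
  have hn : 1 ≤ n := by
    obtain ⟨j, hj⟩ := hne
    have := Finset.mem_Icc.1 (hJ hj)
    omega
  have : NeZero ((insert (n + 1) J).gcd id) := ⟨fun h =>
    Nat.succ_ne_zero n (Finset.gcd_eq_zero_iff.1 h (n + 1) (Finset.mem_insert_self _ _))⟩
  refine fiberGroupIs_zmod_of_isSolution X he hJ _ (Finset.left_mem_Icc.2 hn)
    (fun f hf h k => ?_) (fun f hf => ?_) (fun t ht => ?_)
  · rcases le_or_gt k n with hk | hk
    · rw [hf.eq_nsmul_A k (by omega), h, smul_zero]
    · exact hf.of_lt k hk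
  -- The chain relation extends to the fictitious node `n + 1`, where `f` is `0`; this gives `(n +
  -- 1) • f 1 = 0`.
  · rw [gcd_nsmul_eq_zero_iff, Finset.forall_mem_insert, ← hf.eq_nsmul_A _ le_rfl]
    refine ⟨hf.of_lt _ (Nat.lt_succ_self n), fun j hj => ?_⟩
    rw [← hf.eq_nsmul_A j (by have := Finset.mem_Icc.1 (hJ hj); omega)]
    exact hf.vanish j hj
  · rw [gcd_nsmul_eq_zero_iff, Finset.forall_mem_insert] at ht
    refine ⟨fun k => k • t, (isColumnSolution_A (zero_smul ℕ t)).2 fun j hj => ?_, ht.2,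
      one_smul ℕ t⟩
    have h : (if j + 2 ≤ n then (j + 2) • t else 0) = (j + 2) • t := by
      split_ifs with h
      · rfl
      · rw [show j + 2 = n + 1 by omega, ht.1]
    rw [h]
    module

theorem IsSolution.eq_nsmul_B {f : ℕ → AddUnits} (hf : IsSolution (CartanMatrix.B n) J f) :
    ∀ k ≤ n, f k = k • f 1 := by
  refine eq_nsmul_of_recurrence hf.zero fun j hj => ?_
  have h := (isColumnSolution_B hf.zero).1 hf.col j (by omega)
  rwa [if_pos hj, if_neg (by omega)] at h

/-- The last column reads `2 f n = 2 f (n - 1)`, and consecutive terms differ by `f 1`. -/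
theorem IsSolution.two_nsmul_B {f : ℕ → AddUnits} (hf : IsSolution (CartanMatrix.B n) J f)
    (hn : 1 ≤ n) : 2 • f 1 = 0 := by
  obtain ⟨m, rfl⟩ := Nat.exists_eq_add_of_le' hn
  have h := (isColumnSolution_B hf.zero).1 hf.col m (by omega)
  rw [if_pos (by omega), if_neg (by omega), hf.eq_nsmul_B _ le_rfl,
    hf.eq_nsmul_B m (by omega)] at h
  rw [← h]
  module

theorem fiberGroupIs_B (he : HasCartanMatrix b (CartanMatrix.B n) e) (hJ : J ⊆ Finset.Icc 1 n)
    (hne : J.Nonempty) (heven : ∀ j ∈ J, Even j) :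
    FiberGroupIs X (simpleRootsOf b e J) (Multiplicative (ZMod 2)) := by
  have hn : 1 ≤ n := by
    obtain ⟨j, hj⟩ := hne
    have := Finset.mem_Icc.1 (hJ hj)
    omega
  refine fiberGroupIs_zmod_of_isSolution X he hJ _ (Finset.left_mem_Icc.2 hn)
    (fun f hf h k => ?_) (fun f hf => hf.two_nsmul_B hn) (fun t ht => ?_)
  · rcases le_or_gt k n with hk | hk
    · rw [hf.eq_nsmul_B k hk, h, smul_zero]
    · exact hf.of_lt k hk
  · refine ⟨fun k => k • t, (isColumnSolution_B (zero_smul ℕ t)).2 fun j hj => ?_,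
      fun j hj => even_nsmul_eq_zero ht (heven j hj), one_smul ℕ t⟩
    rcases lt_or_ge (j + 1) n with h | h
    · rw [if_neg (by omega), if_pos (by omega)]
      module
    · rw [if_pos (by omega), if_neg (by omega)]
      linear_combination (norm := module) ht

theorem fiberGroupIs_B_of_odd (he : HasCartanMatrix b (CartanMatrix.B n) e)
    (hJ : J ⊆ Finset.Icc 1 n) (hodd : ¬ ∀ j ∈ J, Even j) :
    FiberGroupIs X (simpleRootsOf b e J) Unit := by
  push Not at hodd
  obtain ⟨j, hj, hj'⟩ := hodd
  have hjn := Finset.mem_Icc.1 (hJ hj)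
  refine fiberGroupIs_unit_of_isSolution X he hJ fun f hf k => ?_
  have h1 : f 1 = 0 := by
    rw [← odd_nsmul_eq_self (hf.two_nsmul_B (by omega)) hj',
      ← hf.eq_nsmul_B j hjn.2, hf.vanish j hj]
  rcases le_or_gt k n with hk | hk
  · rw [hf.eq_nsmul_B k hk, h1, smul_zero]
  · exact hf.of_lt k hk

theorem IsSolution.eq_zero_C {f : ℕ → AddUnits} (hf : IsSolution (CartanMatrix.C n) J f) :
    ∀ k, k ≠ n → f k = 0 := by
  have key : ∀ k ≤ n - 1, f k = k • f 1 := by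
    refine eq_nsmul_of_recurrence hf.zero fun j hj => ?_
    have h := (isColumnSolution_C hf.zero).1 hf.col j (by omega)
    rwa [if_neg (by omega), if_pos (by omega)] at h
  intro k hk
  rcases le_or_gt k n with h | h
  · rcases le_or_gt n 1 with hn | hn
    · rw [show k = 0 by omega, hf.zero]
    · obtain ⟨m, rfl⟩ := Nat.exists_eq_add_of_le' hn
      have h1 := (isColumnSolution_C hf.zero).1 hf.col m (by omega)
      have h2 := (isColumnSolution_C hf.zero).1 hf.col (m + 1) (by omega)
      simp only [Nat.succ_eq_add_one, Nat.reduceAdd] at h1 h2 key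
      rw [if_pos trivial, if_pos le_rfl, key m (by omega), key (m + 1) (by omega)] at h1
      rw [if_neg (by omega), if_neg (by omega), key (m + 1) (by omega), smul_zero, add_zero] at h2
      -- The last two columns are `2 f (n - 1) - f (n - 2) - 2 f n = 0` and `2 f n - f (n - 1) = 0`;
      -- their sum is `f (n - 1) - f (n - 2) = 0`, which is `f 1 = 0`.
      have h3 : f 1 = 0 := by
        have := congrArg₂ (· + ·) h1 h2
        simp only [add_zero] at this
        rw [← this]
        module
      rw [key k (by omega), h3, smul_zero]
  · exact hf.of_lt k h

theorem fiberGroupIs_C (he : HasCartanMatrix b (CartanMatrix.C n) e) (hJ : J ⊆ Finset.Icc 1 n)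
    (hne : J.Nonempty) (hnJ : n ∉ J) :
    FiberGroupIs X (simpleRootsOf b e J) (Multiplicative (ZMod 2)) := by
  have hn : 1 ≤ n := by
    obtain ⟨j, hj⟩ := hne
    have := Finset.mem_Icc.1 (hJ hj)
    omega
  refine fiberGroupIs_zmod_of_isSolution X he hJ _ (Finset.right_mem_Icc.2 hn)
    (fun f hf h k => ?_) (fun f hf => ?_) (fun t ht => ?_)
  · by_cases hk : k = n
    · rw [hk, h]
    · exact hf.eq_zero_C k hk
  · obtain ⟨m, rfl⟩ := Nat.exists_eq_add_of_le' hn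
    have h := (isColumnSolution_C hf.zero).1 hf.col m (by omega)
    rw [if_neg (by omega), if_neg (by omega), hf.eq_zero_C m (by omega)] at h
    rw [← h]
    module
  · refine ⟨fun k => if k = n then t else 0,
      (isColumnSolution_C (if_neg (by omega))).2 fun j hj => ?_,
      fun j hj => if_neg fun h : j = n => hnJ (h ▸ hj), if_pos rfl⟩
    rw [if_neg (show j ≠ n by omega)]
    by_cases h1 : j + 1 = n
    · rw [if_pos h1, if_neg (by omega), if_neg (by omega)]
      linear_combination (norm := module) ht
    · rw [if_neg h1]
      by_cases h2 : j + 2 = n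
      · rw [if_pos h2, if_pos h2.le, if_pos h2]
        linear_combination (norm := module) (-1 : ℤ) • ht
      · rw [if_neg h2, if_neg h2, ite_self]
        module

theorem fiberGroupIs_C_of_mem (he : HasCartanMatrix b (CartanMatrix.C n) e)
    (hJ : J ⊆ Finset.Icc 1 n) (hnJ : n ∈ J) :
    FiberGroupIs X (simpleRootsOf b e J) Unit := by
  refine fiberGroupIs_unit_of_isSolution X he hJ fun f hf k => ?_
  by_cases hk : k = n
  · rw [hk, hf.vanish n hnJ]
  · exact hf.eq_zero_C k hk

/-! ### Type `D_n`. -/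

section D

variable {f : ℕ → AddUnits}

theorem IsSolution.eq_nsmul_D (hf : IsSolution (CartanMatrix.D n) J f) (hn : 3 ≤ n) :
    ∀ k ≤ n - 2, f k = k • f 1 :=
  eq_nsmul_of_recurrence hf.zero fun j hj =>
    ((isColumnSolution_D hf.zero hn).1 hf.col).1 j (by omega)

theorem IsSolution.add_eq_D (hf : IsSolution (CartanMatrix.D n) J f) (hn : 3 ≤ n) :
    f (n - 1) + f n = (n - 1) • f 1 := by
  have h := ((isColumnSolution_D hf.zero hn).1 hf.col).2.1
  rw [hf.eq_nsmul_D hn (n - 2) le_rfl, hf.eq_nsmul_D hn (n - 3) (by omega)] at h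
  obtain ⟨m, rfl⟩ := Nat.exists_eq_add_of_le' hn
  simp only [show m + 3 - 2 = m + 1 by omega, show m + 3 - 3 = m by omega,
    show m + 3 - 1 = m + 2 by omega] at h ⊢
  rw [← sub_eq_zero, ← neg_eq_zero, ← h]
  module

theorem IsSolution.two_nsmul_pred_D (hf : IsSolution (CartanMatrix.D n) J f) (hn : 3 ≤ n) :
    2 • f (n - 1) = (n - 2) • f 1 := by
  have h := ((isColumnSolution_D hf.zero hn).1 hf.col).2.2.1
  rw [hf.eq_nsmul_D hn (n - 2) le_rfl] at h
  rw [← sub_eq_zero, ← h]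
  module

theorem IsSolution.two_nsmul_last_D (hf : IsSolution (CartanMatrix.D n) J f) (hn : 3 ≤ n) :
    2 • f n = (n - 2) • f 1 := by
  have h := ((isColumnSolution_D hf.zero hn).1 hf.col).2.2.2
  rw [hf.eq_nsmul_D hn (n - 2) le_rfl] at h
  rw [← sub_eq_zero, ← h]
  module

/-- Doubling the branch relation gives `2 (n - 1) • f 1`, while the two end nodes contribute `(n -
2) • f 1` each. -/
theorem IsSolution.two_nsmul_D (hf : IsSolution (CartanMatrix.D n) J f) (hn : 3 ≤ n) :
    2 • f 1 = 0 := by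
  have h1 := hf.add_eq_D hn
  have h2 := hf.two_nsmul_pred_D hn
  have h3 := hf.two_nsmul_last_D hn
  obtain ⟨m, rfl⟩ := Nat.exists_eq_add_of_le' hn
  simp only [show m + 3 - 2 = m + 1 by omega, show m + 3 - 1 = m + 2 by omega] at h1 h2 h3
  have h4 : 2 • (m + 2) • f 1 = (m + 1) • f 1 + (m + 1) • f 1 := by
    rw [← h1, smul_add, h2, h3]
  rw [← sub_eq_zero] at h4
  rw [← h4]
  module

theorem IsSolution.eq_zero_D (hf : IsSolution (CartanMatrix.D n) J f) (hn : 3 ≤ n)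
    (h1 : f 1 = 0) (h2 : f (n - 1) = 0) (k : ℕ) : f k = 0 := by
  have h3 := hf.add_eq_D hn
  rw [h1, h2, smul_zero, zero_add] at h3
  rcases le_or_gt k (n - 2) with hk | hk
  · rw [hf.eq_nsmul_D hn k hk, h1, smul_zero]
  · rcases lt_or_ge n k with hk' | hk'
    · exact hf.of_lt k hk'
    · obtain rfl | rfl : k = n - 1 ∨ k = n := by omega
      · exact h2
      · exact h3

theorem fiberGroupIs_D_center (he : HasCartanMatrix b (CartanMatrix.D n) e)
    (hJ : J ⊆ Finset.Icc 1 n) (hn : 3 ≤ n) (h1 : n - 1 ∉ J) (h2 : n ∉ J) (heven : ∀ j ∈ J, Even j) :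
    FiberGroupIs X (simpleRootsOf b e J) (center H) := by
  refine fiberGroupIs_center_of_isSolution X he hJ fun f hf j hj => ?_
  have hjn := Finset.mem_Icc.1 (hJ hj)
  have hj1 : j ≠ n - 1 := fun h => h1 (h ▸ hj)
  have hj2 : j ≠ n := fun h => h2 (h ▸ hj)
  rw [hf.eq_nsmul_D hn j (by omega)]
  exact even_nsmul_eq_zero (hf.two_nsmul_D hn) (heven j hj)

theorem fiberGroupIs_D_of_odd (he : HasCartanMatrix b (CartanMatrix.D n) e)
    (hJ : J ⊆ Finset.Icc 1 n) (hn : 3 ≤ n) (h1 : n - 1 ∉ J) (h2 : n ∉ J)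
    (hodd : ¬ ∀ j ∈ J, Even j) :
    FiberGroupIs X (simpleRootsOf b e J) (Multiplicative (ZMod 2)) := by
  push Not at hodd
  obtain ⟨j, hj, hj'⟩ := hodd
  have hjn := Finset.mem_Icc.1 (hJ hj)
  have hj1 : j ≠ n - 1 := fun h => h1 (h ▸ hj)
  have hj2 : j ≠ n := fun h => h2 (h ▸ hj)
  have hf1 : ∀ f, IsSolution (CartanMatrix.D n) J f → f 1 = 0 := by
    intro f hf
    rw [← odd_nsmul_eq_self (hf.two_nsmul_D hn) hj',
      ← hf.eq_nsmul_D hn j (by omega), hf.vanish j hj]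
  refine fiberGroupIs_zmod_of_isSolution X he hJ _ (i := n - 1)
    (Finset.mem_Icc.2 ⟨by omega, by omega⟩)
    (fun f hf h => hf.eq_zero_D hn (hf1 f hf) h) (fun f hf => ?_) (fun t ht => ?_)
  · rw [hf.two_nsmul_pred_D hn, hf1 f hf, smul_zero]
  -- With `f 1 = 0` only the two end nodes survive; their values are opposite and 2-torsion, hence
  -- equal.
  · refine ⟨fun k => if k = n - 1 ∨ k = n then t else 0,
      (isColumnSolution_D (if_neg (by omega)) hn).2 ⟨fun k hk => ?_, ?_, ?_, ?_⟩,
      fun k hk => if_neg ?_, if_pos (Or.inl rfl)⟩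
    · rw [if_neg (by omega), if_neg (by omega), if_neg (by omega)]
      module
    · rw [if_neg (by omega), if_neg (by omega), if_pos (by omega), if_pos (by omega)]
      linear_combination (norm := module) (-1 : ℤ) • ht
    · rw [if_neg (show ¬ (n - 2 = n - 1 ∨ n - 2 = n) by omega), if_pos (by omega)]
      linear_combination (norm := module) ht
    · rw [if_neg (show ¬ (n - 2 = n - 1 ∨ n - 2 = n) by omega), if_pos (by omega)]
      linear_combination (norm := module) ht
    · rintro (rfl | rfl)
      · exact h1 hk
      · exact h2 hk

/-- The solution `(t, 0, t, 0, …, t, 0, x, y)` for `D_n`, `n` even. -/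
theorem isColumnSolution_D_even (hn : 3 ≤ n) (hn2 : Even n) {t x y : AddUnits} (ht : 2 • t = 0)
    (hx : 2 • x = 0) (hxy : x + y = t) :
    IsColumnSolution (CartanMatrix.D n)
      (fun k => if k = n - 1 then x else if k = n then y else k • t) := by
  have hy : 2 • y = 0 := by
    rw [← hxy, smul_add, hx, zero_add] at ht
    exact ht
  refine (isColumnSolution_D ?_ hn).2 ⟨fun k hk => ?_, ?_, ?_, ?_⟩
  · rw [if_neg (by omega), if_neg (by omega), zero_smul]
  · simp only [show k + 1 ≠ n - 1 by omega, show k + 1 ≠ n by omega, show k ≠ n - 1 by omega,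
      show k ≠ n by omega, show k + 2 ≠ n - 1 by omega, show k + 2 ≠ n by omega, if_false]
    module
  · simp only [show n - 2 ≠ n - 1 by omega, show n - 2 ≠ n by omega, show n - 3 ≠ n - 1 by omega,
      show n - 3 ≠ n by omega, show n ≠ n - 1 by omega, if_false, if_true]
    rw [even_nsmul_eq_zero ht (by rcases hn2 with ⟨m, rfl⟩; exact ⟨m - 1, by omega⟩),
      odd_nsmul_eq_self ht (by rw [Nat.not_even_iff_odd]; rcases hn2 with ⟨m, rfl⟩; exact ⟨m - 2,
          by omega⟩)]
    linear_combination (norm := module) (-1 : ℤ) • ht + (-1 : ℤ) • hxy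
  · simp only [show n - 2 ≠ n - 1 by omega, show n - 2 ≠ n by omega, if_false, if_true]
    rw [even_nsmul_eq_zero ht (by rcases hn2 with ⟨m, rfl⟩; exact ⟨m - 1, by omega⟩)]
    linear_combination (norm := module) hx
  · simp only [show n - 2 ≠ n - 1 by omega, show n - 2 ≠ n by omega, show n ≠ n - 1 by omega,
      if_false, if_true]
    rw [even_nsmul_eq_zero ht (by rcases hn2 with ⟨m, rfl⟩; exact ⟨m - 1, by omega⟩)]
    linear_combination (norm := module) hy

theorem fiberGroupIs_D_of_xor (he : HasCartanMatrix b (CartanMatrix.D n) e)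
    (hJ : J ⊆ Finset.Icc 1 n) (hn : 3 ≤ n) (hxor : Xor (n - 1 ∈ J) (n ∈ J))
    (heven : ∀ j ∈ J, j < n - 1 → Even j) (hn2 : Even n) :
    FiberGroupIs X (simpleRootsOf b e J) (Multiplicative (ZMod 2)) := by
  refine fiberGroupIs_zmod_of_isSolution X he hJ _ (Finset.left_mem_Icc.2 (by omega))
    (fun f hf h => hf.eq_zero_D hn h ?_) (fun f hf => hf.two_nsmul_D hn) (fun t ht => ?_)
  · rcases hxor with ⟨h1, -⟩ | ⟨h1, -⟩
    · exact hf.vanish _ h1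
    · have := hf.add_eq_D hn
      rwa [hf.vanish _ h1, h, smul_zero, add_zero] at this
  -- The end values are `(0, t)` if `n - 1 ∈ J` and `(t, 0)` if `n ∈ J`.
  · rcases hxor with ⟨h1, h2⟩ | ⟨h1, h2⟩
    · refine ⟨_, isColumnSolution_D_even hn hn2 ht (smul_zero 2) (zero_add t), fun j hj => ?_, ?_⟩
      · have hjn := Finset.mem_Icc.1 (hJ hj)
        split_ifs with h3 h4
        · rfl
        · exact absurd (h4 ▸ hj) h2
        · exact even_nsmul_eq_zero ht (heven j hj (by omega))
      · rw [if_neg (by omega), if_neg (by omega), one_smul]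
    · refine ⟨_, isColumnSolution_D_even hn hn2 ht ht (add_zero t), fun j hj => ?_, ?_⟩
      · have hjn := Finset.mem_Icc.1 (hJ hj)
        split_ifs with h3 h4
        · exact absurd (h3 ▸ hj) h2
        · rfl
        · exact even_nsmul_eq_zero ht (heven j hj (by omega))
      · rw [if_neg (by omega), if_neg (by omega), one_smul]

theorem fiberGroupIs_D_unit (he : HasCartanMatrix b (CartanMatrix.D n) e)
    (hJ : J ⊆ Finset.Icc 1 n) (hn : 3 ≤ n) (h : ¬ (n - 1 ∉ J ∧ n ∉ J))
    (h' : ¬ (Xor (n - 1 ∈ J) (n ∈ J) ∧ (∀ j ∈ J, j < n - 1 → Even j) ∧ Even n ∧ 4 ≤ n)) :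
    FiberGroupIs X (simpleRootsOf b e J) Unit := by
  refine fiberGroupIs_unit_of_isSolution X he hJ fun f hf => ?_
  have h2 := hf.two_nsmul_D hn
  have hsum := hf.add_eq_D hn
  have hodd : ¬ Even n → f 1 = 0 := by
    intro hn2
    have hn2' : ¬ Even (n - 2) := by
      rw [Nat.not_even_iff_odd] at hn2 ⊢
      obtain ⟨m, rfl⟩ := hn2
      exact ⟨m - 1, by omega⟩
    by_cases h1 : n - 1 ∈ J
    · have := hf.two_nsmul_pred_D hn
      rwa [hf.vanish _ h1, smul_zero, odd_nsmul_eq_self h2 hn2', eq_comm] at this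
    · have := hf.two_nsmul_last_D hn
      rwa [hf.vanish _ (by tauto), smul_zero, odd_nsmul_eq_self h2 hn2', eq_comm] at this
  -- An odd `j < n - 1` in `J` gives `f 1 = j • f 1 = 0`. For odd `n`, a vanishing end node gives
  -- `(n - 2) • f 1 = 0`. For even `n` both end nodes lie in `J`, and the branch relation gives `(n
  -- - 1) • f 1 = 0`. Each multiplier is odd and `f 1` is 2-torsion.
  have hf1 : f 1 = 0 := by
    by_cases heven : ∀ j ∈ J, j < n - 1 → Even j
    · by_cases hn2 : Even n
      · have hn4 : 4 ≤ n := by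
          rcases hn2 with ⟨m, rfl⟩
          omega
        have hboth : n - 1 ∈ J ∧ n ∈ J := by
          unfold Xor at h'
          tauto
        have hn1 : ¬ Even (n - 1) := by
          rw [Nat.not_even_iff_odd]
          obtain ⟨m, rfl⟩ := hn2
          exact ⟨m - 1, by omega⟩
        rwa [hf.vanish _ hboth.1, hf.vanish _ hboth.2, add_zero, odd_nsmul_eq_self h2 hn1,
          eq_comm] at hsum
      · exact hodd hn2
    · push Not at heven
      obtain ⟨j, hj, hjn, hj'⟩ := heven
      rw [← odd_nsmul_eq_self h2 hj', ← hf.eq_nsmul_D hn j (by omega),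
        hf.vanish j hj]
  refine hf.eq_zero_D hn hf1 ?_
  by_cases h1 : n - 1 ∈ J
  · exact hf.vanish _ h1
  · rwa [hf.vanish n (by tauto), hf1, smul_zero, add_zero] at hsum

end D

end Types

/-! ### Types `E₆` and `E₇`. -/

section Exceptional

variable {f : ℕ → AddUnits}

theorem isColumnSolution_E₆ : IsColumnSolution CartanMatrix.E₆ f ↔
    (2 : ℤ) • f 1 + -f 3 = 0 ∧ (2 : ℤ) • f 2 + -f 4 = 0 ∧
    -f 1 + ((2 : ℤ) • f 3 + -f 4) = 0 ∧ -f 2 + (-f 3 + ((2 : ℤ) • f 4 + -f 5)) = 0 ∧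
    -f 4 + ((2 : ℤ) • f 5 + -f 6) = 0 ∧ -f 5 + (2 : ℤ) • f 6 = 0 := by
  rw [IsColumnSolution]
  simp only [Fin.forall_fin_succ, Fin.sum_univ_succ, CartanMatrix.E₆]
  simp

theorem isColumnSolution_E₇ : IsColumnSolution CartanMatrix.E₇ f ↔
    (2 : ℤ) • f 1 + -f 3 = 0 ∧ (2 : ℤ) • f 2 + -f 4 = 0 ∧
    -f 1 + ((2 : ℤ) • f 3 + -f 4) = 0 ∧ -f 2 + (-f 3 + ((2 : ℤ) • f 4 + -f 5)) = 0 ∧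
    -f 4 + ((2 : ℤ) • f 5 + -f 6) = 0 ∧ -f 5 + ((2 : ℤ) • f 6 + -f 7) = 0 ∧
    -f 6 + (2 : ℤ) • f 7 = 0 := by
  rw [IsColumnSolution]
  simp only [Fin.forall_fin_succ, Fin.sum_univ_succ, CartanMatrix.E₇]
  simp

/-- The coefficients are those combinations of rows of the inverse Cartan matrix that are integral;
for example `f 2` and `f 4` vanish because the fundamental weights `ω₂` and `ω₄` lie in the root
lattice. -/
theorem IsColumnSolution.eq_E₆ (h : IsColumnSolution CartanMatrix.E₆ f) :
    3 • f 1 = 0 ∧ f 2 = 0 ∧ f 3 = 2 • f 1 ∧ f 4 = 0 ∧ f 5 = f 1 ∧ f 6 = 2 • f 1 := by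
  obtain ⟨h1, h2, h3, h4, h5, h6⟩ := isColumnSolution_E₆.1 h
  refine ⟨?_, ?_, ?_, ?_, ?_, ?_⟩
  · linear_combination (norm := module) (4 : ℤ) • h1 + (3 : ℤ) • h2 + (5 : ℤ) • h3 +
      (6 : ℤ) • h4 + (4 : ℤ) • h5 + (2 : ℤ) • h6
  · linear_combination (norm := module) (1 : ℤ) • h1 + (2 : ℤ) • h2 + (2 : ℤ) • h3 +
      (3 : ℤ) • h4 + (2 : ℤ) • h5 + (1 : ℤ) • h6
  · linear_combination (norm := module) (-1 : ℤ) • h1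
  · linear_combination (norm := module) (2 : ℤ) • h1 + (3 : ℤ) • h2 + (4 : ℤ) • h3 +
      (6 : ℤ) • h4 + (4 : ℤ) • h5 + (2 : ℤ) • h6
  · linear_combination (norm := module) (1 : ℤ) • h2 + (1 : ℤ) • h3 + (2 : ℤ) • h4 +
      (2 : ℤ) • h5 + (1 : ℤ) • h6
  · linear_combination (norm := module) (-2 : ℤ) • h1 + (-1 : ℤ) • h2 + (-2 : ℤ) • h3 +
      (-2 : ℤ) • h4 + (-1 : ℤ) • h5

/-- Again the coefficients come from the inverse Cartan matrix: `ω₁`, `ω₃`, `ω₄`, `ω₆` lie in the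
root lattice, while `ω₂`, `ω₅`, `ω₇` represent the nontrivial class. -/
theorem IsColumnSolution.eq_E₇ (h : IsColumnSolution CartanMatrix.E₇ f) :
    2 • f 2 = 0 ∧ f 1 = 0 ∧ f 3 = 0 ∧ f 4 = 0 ∧ f 5 = f 2 ∧ f 6 = 0 ∧ f 7 = f 2 := by
  obtain ⟨h1, h2, h3, h4, h5, h6, h7⟩ := isColumnSolution_E₇.1 h
  refine ⟨?_, ?_, ?_, ?_, ?_, ?_, ?_⟩
  · linear_combination (norm := module) (4 : ℤ) • h1 + (7 : ℤ) • h2 + (8 : ℤ) • h3 +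
      (12 : ℤ) • h4 + (9 : ℤ) • h5 + (6 : ℤ) • h6 + (3 : ℤ) • h7
  · linear_combination (norm := module) (2 : ℤ) • h1 + (2 : ℤ) • h2 + (3 : ℤ) • h3 +
      (4 : ℤ) • h4 + (3 : ℤ) • h5 + (2 : ℤ) • h6 + (1 : ℤ) • h7
  · linear_combination (norm := module) (3 : ℤ) • h1 + (4 : ℤ) • h2 + (6 : ℤ) • h3 +
      (8 : ℤ) • h4 + (6 : ℤ) • h5 + (4 : ℤ) • h6 + (2 : ℤ) • h7
  · linear_combination (norm := module) (4 : ℤ) • h1 + (6 : ℤ) • h2 + (8 : ℤ) • h3 +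
      (12 : ℤ) • h4 + (9 : ℤ) • h5 + (6 : ℤ) • h6 + (3 : ℤ) • h7
  · linear_combination (norm := module) (1 : ℤ) • h1 + (1 : ℤ) • h2 + (2 : ℤ) • h3 +
      (3 : ℤ) • h4 + (3 : ℤ) • h5 + (2 : ℤ) • h6 + (1 : ℤ) • h7
  · linear_combination (norm := module) (2 : ℤ) • h1 + (3 : ℤ) • h2 + (4 : ℤ) • h3 +
      (6 : ℤ) • h4 + (5 : ℤ) • h5 + (4 : ℤ) • h6 + (2 : ℤ) • h7
  · linear_combination (norm := module) (-1 : ℤ) • h1 + (-2 : ℤ) • h2 + (-2 : ℤ) • h3 +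
      (-3 : ℤ) • h4 + (-2 : ℤ) • h5 + (-1 : ℤ) • h6

theorem IsSolution.eq_zero_E₆ {J : Finset ℕ} (hf : IsSolution CartanMatrix.E₆ J f)
    (h : f 1 = 0) (k : ℕ) : f k = 0 := by
  obtain ⟨-, h2, h3, h4, h5, h6⟩ := hf.col.eq_E₆
  rw [h, smul_zero] at h3 h6
  rw [h] at h5
  rcases lt_or_ge 6 k with hk | hk
  · exact hf.of_lt k hk
  · interval_cases k
    · exact hf.zero
    all_goals assumption

theorem IsSolution.eq_zero_E₇ {J : Finset ℕ} (hf : IsSolution CartanMatrix.E₇ J f)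
    (h : f 2 = 0) (k : ℕ) : f k = 0 := by
  obtain ⟨-, h1, h3, h4, h5, h6, h7⟩ := hf.col.eq_E₇
  rw [h] at h5 h7
  rcases lt_or_ge 7 k with hk | hk
  · exact hf.of_lt k hk
  · interval_cases k
    · exact hf.zero
    all_goals assumption

variable {b : (rootSystem H).Base} (X : SimpleRootVectors b) {J : Finset ℕ}

theorem fiberGroupIs_E₆ {e : Fin 6 ≃ b.support} (he : HasCartanMatrix b CartanMatrix.E₆ e)
    (hJ : J ⊆ Finset.Icc 1 6) (h : 1 ∉ J ∧ 3 ∉ J ∧ 5 ∉ J ∧ 6 ∉ J) :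
    FiberGroupIs X (simpleRootsOf b e J) (Multiplicative (ZMod 3)) := by
  refine fiberGroupIs_zmod_of_isSolution X he hJ _ (i := 1) (by decide)
    (fun f hf h => hf.eq_zero_E₆ h) (fun f hf => hf.col.eq_E₆.1) (fun t ht => ?_)
  -- This is the sequence `(t, 0, 2t, 0, t, 2t)` prescribed by `IsColumnSolution.eq_E₆`.
  refine ⟨fun k => if k = 2 ∨ k = 4 then 0 else if k = 1 ∨ k = 5 then t else 2 • t,
    isColumnSolution_E₆.2 ?_, fun j hj => ?_, by simp⟩
  · simp only [Nat.reduceEqDiff, OfNat.ofNat_ne_one, OfNat.one_ne_ofNat, or_true, true_or,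
      or_self, if_true, if_false]
    refine ⟨?_, ?_, ?_, ?_, ?_, ?_⟩
    · module
    · module
    · linear_combination (norm := module) ht
    · linear_combination (norm := module) (-1 : ℤ) • ht
    · module
    · linear_combination (norm := module) ht
  · have hj' := Finset.mem_Icc.1 (hJ hj)
    obtain rfl | rfl : j = 2 ∨ j = 4 := by
      obtain ⟨h1, h3, h5, h6⟩ := h
      obtain ⟨hj1, hj6⟩ := hj'
      interval_cases j <;> simp_all
    all_goals simp

theorem fiberGroupIs_E₆_unit {e : Fin 6 ≃ b.support} (he : HasCartanMatrix b CartanMatrix.E₆ e)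
    (hJ : J ⊆ Finset.Icc 1 6) (h : ¬ (1 ∉ J ∧ 3 ∉ J ∧ 5 ∉ J ∧ 6 ∉ J)) :
    FiberGroupIs X (simpleRootsOf b e J) Unit := by
  refine fiberGroupIs_unit_of_isSolution X he hJ fun f hf => hf.eq_zero_E₆ ?_
  obtain ⟨h1, -, h3, -, h5, h6⟩ := hf.col.eq_E₆
  obtain h | h | h | h : 1 ∈ J ∨ 3 ∈ J ∨ 5 ∈ J ∨ 6 ∈ J := by tauto
  · exact hf.vanish _ h
  · rw [hf.vanish _ h] at h3
    linear_combination (norm := module) h1 + h3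
  · rw [← h5, hf.vanish _ h]
  · rw [hf.vanish _ h] at h6
    linear_combination (norm := module) h1 + h6

theorem fiberGroupIs_E₇ {e : Fin 7 ≃ b.support} (he : HasCartanMatrix b CartanMatrix.E₇ e)
    (hJ : J ⊆ Finset.Icc 1 7) (h : 2 ∉ J ∧ 5 ∉ J ∧ 7 ∉ J) :
    FiberGroupIs X (simpleRootsOf b e J) (Multiplicative (ZMod 2)) := by
  refine fiberGroupIs_zmod_of_isSolution X he hJ _ (i := 2) (by decide)
    (fun f hf h => hf.eq_zero_E₇ h) (fun f hf => hf.col.eq_E₇.1) (fun t ht => ?_)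
  refine ⟨fun k => if k = 2 ∨ k = 5 ∨ k = 7 then t else 0,
    isColumnSolution_E₇.2 ?_, fun j hj => if_neg ?_, by simp⟩
  · simp only [Nat.reduceEqDiff, OfNat.one_ne_ofNat, or_true, true_or,
      or_self, if_true, if_false]
    refine ⟨?_, ?_, ?_, ?_, ?_, ?_, ?_⟩
    · module
    · linear_combination (norm := module) ht
    · module
    · linear_combination (norm := module) (-1 : ℤ) • ht
    · linear_combination (norm := module) ht
    · linear_combination (norm := module) (-1 : ℤ) • ht
    · linear_combination (norm := module) ht
  · rintro (rfl | rfl | rfl)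
    · exact h.1 hj
    · exact h.2.1 hj
    · exact h.2.2 hj

theorem fiberGroupIs_E₇_unit {e : Fin 7 ≃ b.support} (he : HasCartanMatrix b CartanMatrix.E₇ e)
    (hJ : J ⊆ Finset.Icc 1 7) (h : ¬ (2 ∉ J ∧ 5 ∉ J ∧ 7 ∉ J)) :
    FiberGroupIs X (simpleRootsOf b e J) Unit := by
  refine fiberGroupIs_unit_of_isSolution X he hJ fun f hf => hf.eq_zero_E₇ ?_
  obtain ⟨-, -, -, -, h5, -, h7⟩ := hf.col.eq_E₇
  obtain h | h | h : 2 ∈ J ∨ 5 ∈ J ∨ 7 ∈ J := by tauto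
  · exact hf.vanish _ h
  · rw [← h5, hf.vanish _ h]
  · rw [← h7, hf.vanish _ h]

end Exceptional

end Graham

end

theorem mainTheorem6 {L : Type*} [LieRing L] [LieAlgebra ℂ L] [FiniteDimensional ℂ L]
    [LieAlgebra.IsSemisimple ℂ L] (H : LieSubalgebra ℂ L) [H.IsCartanSubalgebra]
    (b : (LieAlgebra.IsKilling.rootSystem H).Base) (X : Graham.SimpleRootVectors b) :
    -- type A
    (∀ (n : ℕ) (e : Fin n ≃ b.support), Graham.HasCartanMatrix b (CartanMatrix.A n) e →
      ∀ J ⊆ Finset.Icc 1 n, J.Nonempty →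
        Graham.FiberGroupIs X (Graham.simpleRootsOf b e J)
          (Multiplicative (ZMod ((insert (n + 1) J).gcd id)))) ∧
    -- type B
    (∀ (n : ℕ) (e : Fin n ≃ b.support), Graham.HasCartanMatrix b (CartanMatrix.B n) e →
      ∀ J ⊆ Finset.Icc 1 n, J.Nonempty →
        ((∀ j ∈ J, Even j) →
          Graham.FiberGroupIs X (Graham.simpleRootsOf b e J) (Multiplicative (ZMod 2))) ∧
        ((¬ ∀ j ∈ J, Even j) →
          Graham.FiberGroupIs X (Graham.simpleRootsOf b e J) Unit)) ∧
    -- type C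
    (∀ (n : ℕ) (e : Fin n ≃ b.support), Graham.HasCartanMatrix b (CartanMatrix.C n) e →
      ∀ J ⊆ Finset.Icc 1 n, J.Nonempty →
        (n ∉ J → Graham.FiberGroupIs X (Graham.simpleRootsOf b e J) (Multiplicative (ZMod 2))) ∧
        (n ∈ J → Graham.FiberGroupIs X (Graham.simpleRootsOf b e J) Unit)) ∧
    -- type D
    (∀ (n : ℕ) (e : Fin n ≃ b.support), 3 ≤ n → Graham.HasCartanMatrix b (CartanMatrix.D n) e →
      ∀ J ⊆ Finset.Icc 1 n, J.Nonempty →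
        ((n - 1 ∉ J ∧ n ∉ J ∧ ∀ j ∈ J, Even j) →
          Graham.FiberGroupIs X (Graham.simpleRootsOf b e J) (Graham.center H)) ∧
        ((n - 1 ∉ J ∧ n ∉ J ∧ ¬ ∀ j ∈ J, Even j) →
          Graham.FiberGroupIs X (Graham.simpleRootsOf b e J) (Multiplicative (ZMod 2))) ∧
        ((Xor (n - 1 ∈ J) (n ∈ J) ∧ (∀ j ∈ J, j < n - 1 → Even j) ∧ Even n ∧ 4 ≤ n) →
          Graham.FiberGroupIs X (Graham.simpleRootsOf b e J) (Multiplicative (ZMod 2))) ∧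
        ((¬ (n - 1 ∉ J ∧ n ∉ J) ∧
          ¬ (Xor (n - 1 ∈ J) (n ∈ J) ∧ (∀ j ∈ J, j < n - 1 → Even j) ∧ Even n ∧ 4 ≤ n)) →
          Graham.FiberGroupIs X (Graham.simpleRootsOf b e J) Unit)) ∧
    -- type E₆
    (∀ e : Fin 6 ≃ b.support, Graham.HasCartanMatrix b CartanMatrix.E₆ e →
      ∀ J ⊆ Finset.Icc 1 6, J.Nonempty →
        ((1 ∉ J ∧ 3 ∉ J ∧ 5 ∉ J ∧ 6 ∉ J) →
          Graham.FiberGroupIs X (Graham.simpleRootsOf b e J) (Multiplicative (ZMod 3))) ∧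
        (¬ (1 ∉ J ∧ 3 ∉ J ∧ 5 ∉ J ∧ 6 ∉ J) →
          Graham.FiberGroupIs X (Graham.simpleRootsOf b e J) Unit)) ∧
    -- type E₇
    (∀ e : Fin 7 ≃ b.support, Graham.HasCartanMatrix b CartanMatrix.E₇ e →
      ∀ J ⊆ Finset.Icc 1 7, J.Nonempty →
        ((2 ∉ J ∧ 5 ∉ J ∧ 7 ∉ J) →
          Graham.FiberGroupIs X (Graham.simpleRootsOf b e J) (Multiplicative (ZMod 2))) ∧
        (¬ (2 ∉ J ∧ 5 ∉ J ∧ 7 ∉ J) →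
          Graham.FiberGroupIs X (Graham.simpleRootsOf b e J) Unit)) := by
  refine ⟨fun n e he J hJ hne => Graham.fiberGroupIs_A X he hJ hne,
    fun n e he J hJ hne => ⟨Graham.fiberGroupIs_B X he hJ hne,
      Graham.fiberGroupIs_B_of_odd X he hJ⟩,
    fun n e he J hJ hne => ⟨Graham.fiberGroupIs_C X he hJ hne,
      Graham.fiberGroupIs_C_of_mem X he hJ⟩,
    fun n e hn he J hJ hne => ⟨?_, ?_, ?_, ?_⟩,
    fun e he J hJ hne => ⟨Graham.fiberGroupIs_E₆ X he hJ, Graham.fiberGroupIs_E₆_unit X he hJ⟩,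
    fun e he J hJ hne => ⟨Graham.fiberGroupIs_E₇ X he hJ, Graham.fiberGroupIs_E₇_unit X he hJ⟩⟩
  · exact fun h => Graham.fiberGroupIs_D_center X he hJ hn h.1 h.2.1 h.2.2
  · exact fun h => Graham.fiberGroupIs_D_of_odd X he hJ hn h.1 h.2.1 h.2.2
  · exact fun h => Graham.fiberGroupIs_D_of_xor X he hJ hn h.1 h.2.1 h.2.2.1
  · exact fun h => Graham.fiberGroupIs_D_unit X he hJ hn h.1 h.2
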